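/- Let $N\ge 1$, let $B_N$ be the open unit ball of $\mathbb{C}^N$, and let $\langle z,w\rangle=\sum_j z_j\overline{w_j}$. Let $\sigma$ be the normalized Lebesgue measure on $\partial B_N$ and $\nu$ the normalized Lebesgue volume measure on $B_N$. The Hardy space $H^2(B_N)$ consists of the holomorphic functions $f$ on $B_N$ with $\|f\|^2=\sup_{0<r<1}\int_{\partial B_N}|f(r\zeta)|^2\,d\sigma(\zeta)<\infty$. For $s>-1$ the weighted Bergman space $A^2_s(B_N)$ consists of the holomorphic functions $f$ on $B_N$ with $\|f\|^2=\int_{B_N}|f(z)|^2 w_s(z)\,d\nu(z)<\infty$, where $w_s(z)=\frac{\Gamma(N+s+1)}{\Gamma(N+1)\Gamma(s+1)}(1-|z|^2)^s$. For a holomorphic map $\varphi:B_N\to B_N$ let $C_\varphi f=f\circ\varphi$, and for $\zeta\in\partial B_N$ let $$d_\varphi(\zeta)=\liminf_{z\to\zeta,\ z\in B_N}\frac{1-|\varphi(z)|}{1-|z|}\in[0,\infty].$$ A restricted $\zeta$-curve is a continuous curve $\Gamma:[0,1)\to B_N$ with $\Gamma(t)\to\zeta$ as $t\to1$ such that, with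 $\gamma(t)=\langle\Gamma(t),\zeta\rangle\zeta$, one has $\frac{|\Gamma(t)-\gamma(t)|^2}{1-|\gamma(t)|^2}\to0$ as $t\to1$ and $\frac{|\gamma(t)-\zeta|}{1-|\gamma(t)|}$ is bounded on $[0,1)$. A function $f:B_N\to\mathbb{C}$ has restricted limit $L\in\mathbb{C}$ at $\zeta$ if $f(\Gamma(t))\to L$ as $t\to1$ for every restricted $\zeta$-curve $\Gamma$. The map $\varphi$ has finite angular derivative at $\zeta$ if for some $\eta\in\partial B_N$ the function $z\mapsto\frac{\langle\eta-\varphi(z),\eta\rangle}{\langle\zeta-z,\zeta\rangle}$ has a (finite) restricted limit at $\zeta$. **Corollary 2.2.** Let $\varphi,\psi$ be holomorphic self-maps of $B_N$. Let $X$ be $H^2(B_N)$ or $A^2_s(B_N)$ for some $s>-1$. Suppose that $C_\varphi$ and $C_\psi$ are bounded on $X$ and that $C_\varphi-C_\psi$ is compact on $X$. Then at every $\zeta\in\partial B_N$ at which $\varphi$ has finite angular derivative, the radial limits $\varphi(\zeta)=\lim_{r\to1^-}\varphi(r\zeta)$ and $\psi(\zeta)=\lim_{r\to1^-}\psi(r\zeta)$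 exist and are equal, and $d_\varphi(\zeta)=d_\psi(\zeta)$. -/

import Mathlib

open Set Filter Topology MeasureTheory Metric
open scoped ENNReal

noncomputable section

/-- Complex Euclidean space `ℂ^N`. The paper's pairing `⟨z, w⟩ = ∑ z_j * conj w_j` is
`inner ℂ w z` in Mathlib's convention (conjugate-linear in the first argument). -/
abbrev CSpace (N : ℕ) : Type := EuclideanSpace ℂ (Fin N)

/-- Normalized surface measure `σ` on the unit sphere of `ℂ^N`. -/
def sphereMeasure (N : ℕ) : Measure (sphere (0 : CSpace N) 1) :=
  ((volume : Measure (CSpace N)).toSphere univ)⁻¹ • (volume : Measure (CSpace N)).toSphere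

/-- Normalized Lebesgue measure `ν` (the unit ball has measure one). -/
def ballMeasure (N : ℕ) : Measure (CSpace N) :=
  ((volume : Measure (CSpace N)) (ball 0 1))⁻¹ • (volume : Measure (CSpace N))

/-- The weight `w_s(z) = Γ(N+s+1) / (Γ(N+1) Γ(s+1)) * (1 - |z|²)^s`. -/
def bergmanWeight (N : ℕ) (s : ℝ) (z : CSpace N) : ℝ :=
  Real.Gamma (N + s + 1) / (Real.Gamma (N + 1) * Real.Gamma (s + 1)) * (1 - ‖z‖ ^ 2) ^ s

/-- The squared Hardy norm `sup_{0<r<1} ∫ |f(rζ)|² dσ(ζ)`, possibly infinite. -/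
def hardySq {N : ℕ} (f : CSpace N → ℂ) : ℝ≥0∞ :=
  ⨆ r ∈ Ioo (0 : ℝ) 1, ∫⁻ ζ : sphere (0 : CSpace N) 1,
    ‖f (r • (ζ : CSpace N))‖ₑ ^ 2 ∂(sphereMeasure N)

/-- The squared Bergman norm `∫_{B_N} |f(z)|² w_s(z) dν(z)`, possibly infinite. -/
def bergmanSq {N : ℕ} (s : ℝ) (f : CSpace N → ℂ) : ℝ≥0∞ :=
  ∫⁻ z in ball (0 : CSpace N) 1,
    ‖f z‖ₑ ^ 2 * ENNReal.ofReal (bergmanWeight N s z) ∂(ballMeasure N)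

/-- Holomorphic functions on the unit ball. Only the values on the ball matter, so a function on
the ball is represented by its extension by zero to `ℂ^N`. -/
def HolOnBall {N : ℕ} (f : CSpace N → ℂ) : Prop :=
  DifferentiableOn ℂ f (ball 0 1) ∧ ∀ z, z ∉ ball (0 : CSpace N) 1 → f z = 0

theorem HolOnBall.add {N : ℕ} {f g : CSpace N → ℂ} (hf : HolOnBall f) (hg : HolOnBall g) :
    HolOnBall (f + g) :=
  ⟨hf.1.add hg.1, fun z hz => by simp [hf.2 z hz, hg.2 z hz]⟩

theorem HolOnBall.smul {N : ℕ} {f : CSpace N → ℂ} (c : ℂ) (hf : HolOnBall f) :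
    HolOnBall (c • f) :=
  ⟨hf.1.const_smul c, fun z hz => by simp [hf.2 z hz]⟩

theorem HolOnBall.zero {N : ℕ} : HolOnBall (0 : CSpace N → ℂ) :=
  ⟨differentiableOn_const 0, fun _ _ => rfl⟩

theorem smul_sphere_mem_ball {N : ℕ} {r : ℝ} (hr : r ∈ Ioo (0 : ℝ) 1)
    (ζ : sphere (0 : CSpace N) 1) : r • (ζ : CSpace N) ∈ ball (0 : CSpace N) 1 := by
  simp [norm_smul, abs_of_pos hr.1, hr.2]

theorem HolOnBall.continuous_dilate {N : ℕ} {f : CSpace N → ℂ} (hf : HolOnBall f)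
    {r : ℝ} (hr : r ∈ Ioo (0 : ℝ) 1) :
    Continuous fun ζ : sphere (0 : CSpace N) 1 => f (r • (ζ : CSpace N)) :=
  hf.1.continuousOn.comp_continuous (by fun_prop) (smul_sphere_mem_ball hr)

/-- Minkowski's inequality for weighted square integrals. -/
theorem lintegral_sq_add_le {α : Type*} [MeasurableSpace α] (μ : Measure α) {f g : α → ℂ}
    (hf : AEMeasurable f μ) (hg : AEMeasurable g μ) :
    ∫⁻ a, ‖f a + g a‖ₑ ^ 2 ∂μ ≤
      ((∫⁻ a, ‖f a‖ₑ ^ 2 ∂μ) ^ (1 / 2 : ℝ) + (∫⁻ a, ‖g a‖ₑ ^ 2 ∂μ) ^ (1 / 2 : ℝ)) ^ 2 := by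
  have h := eLpNorm_add_le hf.aestronglyMeasurable hg.aestronglyMeasurable
    (p := 2) (by norm_num)
  simp only [eLpNorm_eq_lintegral_rpow_enorm_toReal (p := 2) (by norm_num) (by norm_num),
    ENNReal.toReal_ofNat, ENNReal.rpow_ofNat, Pi.add_apply] at h
  calc _ = ((∫⁻ a, ‖f a + g a‖ₑ ^ 2 ∂μ) ^ (1 / 2 : ℝ)) ^ 2 := by
          rw [← ENNReal.rpow_natCast, ← ENNReal.rpow_mul]; norm_num
    _ ≤ _ := by gcongr

theorem hardySq_add_le {N : ℕ} {f g : CSpace N → ℂ} (hf : HolOnBall f) (hg : HolOnBall g) :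
    hardySq (f + g) ≤ (hardySq f ^ (1 / 2 : ℝ) + hardySq g ^ (1 / 2 : ℝ)) ^ 2 := by
  refine iSup₂_le fun r hr => ?_
  refine (lintegral_sq_add_le _ (hf.continuous_dilate hr).measurable.aemeasurable
    (hg.continuous_dilate hr).measurable.aemeasurable).trans ?_
  have h1 : ∀ k : CSpace N → ℂ, ∫⁻ ζ : sphere (0 : CSpace N) 1,
      ‖k (r • (ζ : CSpace N))‖ₑ ^ 2 ∂(sphereMeasure N) ≤ hardySq k := fun k =>
    le_iSup₂ (f := fun (r : ℝ) (_ : r ∈ Ioo (0 : ℝ) 1) => ∫⁻ ζ : sphere (0 : CSpace N) 1,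
      ‖k (r • (ζ : CSpace N))‖ₑ ^ 2 ∂(sphereMeasure N)) r hr
  gcongr <;> exact h1 _

theorem hardySq_smul {N : ℕ} (c : ℂ) (f : CSpace N → ℂ) :
    hardySq (c • f) = ‖c‖ₑ ^ 2 * hardySq f := by
  simp only [hardySq, ENNReal.mul_iSup]
  refine iSup_congr fun r => iSup_congr fun _ => ?_
  rw [← lintegral_const_mul' _ _ (by simp)]
  simp [enorm_mul, mul_pow]

theorem measurable_bergmanWeight (N : ℕ) (s : ℝ) : Measurable (bergmanWeight N s) := by
  unfold bergmanWeight
  fun_prop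

theorem bergmanSq_eq {N : ℕ} (s : ℝ) {f : CSpace N → ℂ} (hf : HolOnBall f) :
    bergmanSq s f = ∫⁻ z, ‖f z‖ₑ ^ 2 ∂(((ballMeasure N).restrict (ball 0 1)).withDensity
      fun z => ENNReal.ofReal (bergmanWeight N s z)) := by
  have hm : AEMeasurable f ((ballMeasure N).restrict (ball 0 1)) :=
    hf.1.continuousOn.aemeasurable measurableSet_ball
  rw [lintegral_withDensity_eq_lintegral_mul₀
    (measurable_bergmanWeight N s).ennreal_ofReal.aemeasurable (by fun_prop)]
  simp [bergmanSq, mul_comm]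

theorem bergmanSq_add_le {N : ℕ} (s : ℝ) {f g : CSpace N → ℂ} (hf : HolOnBall f)
    (hg : HolOnBall g) :
    bergmanSq s (f + g) ≤ (bergmanSq s f ^ (1 / 2 : ℝ) + bergmanSq s g ^ (1 / 2 : ℝ)) ^ 2 := by
  rw [bergmanSq_eq s hf, bergmanSq_eq s hg, bergmanSq_eq s (hf.add hg)]
  have hm : ∀ {k : CSpace N → ℂ}, HolOnBall k →
      AEMeasurable k (((ballMeasure N).restrict (ball 0 1)).withDensity
        fun z => ENNReal.ofReal (bergmanWeight N s z)) := fun hk =>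
    (hk.1.continuousOn.aemeasurable measurableSet_ball).mono_ac
      (withDensity_absolutelyContinuous _ _)
  exact lintegral_sq_add_le _ (hm hf) (hm hg)

theorem bergmanSq_smul {N : ℕ} (s : ℝ) (c : ℂ) (f : CSpace N → ℂ) :
    bergmanSq s (c • f) = ‖c‖ₑ ^ 2 * bergmanSq s f := by
  rw [bergmanSq, bergmanSq, ← lintegral_const_mul' _ _ (by simp)]
  simp [enorm_mul, mul_pow, mul_assoc]

theorem hardySq_zero {N : ℕ} : hardySq (0 : CSpace N → ℂ) = 0 := by
  simpa using hardySq_smul 0 (0 : CSpace N → ℂ)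

theorem bergmanSq_zero {N : ℕ} (s : ℝ) : bergmanSq s (0 : CSpace N → ℂ) = 0 := by
  simpa using bergmanSq_smul s 0 (0 : CSpace N → ℂ)

theorem lt_top_of_le_sq {a b c : ℝ≥0∞} (h : c ≤ (a ^ (1 / 2 : ℝ) + b ^ (1 / 2 : ℝ)) ^ 2)
    (ha : a < ∞) (hb : b < ∞) : c < ∞ :=
  h.trans_lt (ENNReal.pow_lt_top (ENNReal.add_lt_top.2
    ⟨ENNReal.rpow_lt_top_of_nonneg (by norm_num) ha.ne,
      ENNReal.rpow_lt_top_of_nonneg (by norm_num) hb.ne⟩))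

theorem sqrt_toReal_le {a b c : ℝ≥0∞} (h : c ≤ (a ^ (1 / 2 : ℝ) + b ^ (1 / 2 : ℝ)) ^ 2)
    (ha : a < ∞) (hb : b < ∞) : √c.toReal ≤ √a.toReal + √b.toReal := by
  have ha' := ENNReal.rpow_lt_top_of_nonneg (y := 1 / 2) (by norm_num) ha.ne
  have hb' := ENNReal.rpow_lt_top_of_nonneg (y := 1 / 2) (by norm_num) hb.ne
  have h2 := ENNReal.toReal_mono (ENNReal.pow_lt_top (ENNReal.add_lt_top.2 ⟨ha', hb'⟩)).ne h
  rw [ENNReal.toReal_pow, ENNReal.toReal_add ha'.ne hb'.ne, ← ENNReal.toReal_rpow,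
    ← ENNReal.toReal_rpow, ← Real.sqrt_eq_rpow, ← Real.sqrt_eq_rpow] at h2
  exact Real.sqrt_le_iff.2 ⟨by positivity, h2⟩

theorem sqrt_toReal_smul (c : ℂ) (a : ℝ≥0∞) :
    √(‖c‖ₑ ^ 2 * a).toReal = ‖c‖ * √a.toReal := by
  rw [ENNReal.toReal_mul, ENNReal.toReal_pow, toReal_enorm, Real.sqrt_mul (by positivity),
    Real.sqrt_sq (norm_nonneg c)]

instance ballMeasure_isOpenPosMeasure (N : ℕ) : (ballMeasure N).IsOpenPosMeasure :=
  Measure.isOpenPosMeasure_smul _ (by simp [measure_ball_lt_top.ne])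

instance sphereMeasure_isOpenPosMeasure (N : ℕ) : (sphereMeasure N).IsOpenPosMeasure :=
  Measure.isOpenPosMeasure_smul _ (by simp [-Measure.toSphere_apply_univ, measure_ne_top])

theorem eq_zero_of_hardySq_eq_zero {N : ℕ} [NeZero N] {f : CSpace N → ℂ} (hf : HolOnBall f)
    (h : hardySq f = 0) : f = 0 := by
  have key : ∀ z ∈ ball (0 : CSpace N) 1, z ≠ 0 → f z = 0 := by
    intro z hz h0
    have hr : ‖z‖ ∈ Ioo (0 : ℝ) 1 := ⟨norm_pos_iff.2 h0, by simpa using hz⟩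
    have h1 : ∫⁻ ζ : sphere (0 : CSpace N) 1,
        ‖f (‖z‖ • (ζ : CSpace N))‖ₑ ^ 2 ∂(sphereMeasure N) = 0 := by
      have := iSup₂_le_iff.1 h.le ‖z‖ hr
      exact le_antisymm this bot_le
    have hc := hf.continuous_dilate hr
    rw [lintegral_eq_zero_iff (hc.measurable.enorm.pow_const 2)] at h1
    have h2 : (fun ζ : sphere (0 : CSpace N) 1 => f (‖z‖ • (ζ : CSpace N))) =ᵐ[sphereMeasure N]
        fun _ => 0 := by
      filter_upwards [h1] with ζ hζ using by simpa using hζ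
    rw [Continuous.ae_eq_iff_eq _ hc continuous_const] at h2
    have h3 := congrFun h2 ⟨(‖z‖⁻¹ : ℝ) • z, by simp [norm_smul, h0]⟩
    simpa [smul_smul, h0] using h3
  have hcl : EqOn f 0 (ball (0 : CSpace N) 1) := by
    refine Measure.eqOn_open_of_ae_eq (μ := ballMeasure N) ?_ isOpen_ball
      hf.1.continuousOn continuousOn_const
    have hne : ∀ᵐ z ∂((ballMeasure N).restrict (ball 0 1)), z ≠ 0 := by
      refine ae_restrict_of_ae (Measure.ae_smul_measure (Measure.ae_ne volume 0) _)
    filter_upwards [hne, ae_restrict_mem measurableSet_ball] with z hz hb using key z hb hz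
  funext z
  by_cases hz : z ∈ ball (0 : CSpace N) 1
  · exact hcl hz
  · exact hf.2 z hz

theorem bergmanWeight_pos {N : ℕ} {s : ℝ} (hs : -1 < s) {z : CSpace N}
    (hz : z ∈ ball (0 : CSpace N) 1) : 0 < bergmanWeight N s z := by
  have h1 : ‖z‖ < 1 := by simpa using hz
  have h2 : (0 : ℝ) < 1 - ‖z‖ ^ 2 := by nlinarith [norm_nonneg z]
  have hN : (0 : ℝ) ≤ N := N.cast_nonneg
  have := Real.Gamma_pos_of_pos (show (0 : ℝ) < N + s + 1 by linarith)
  have := Real.Gamma_pos_of_pos (show (0 : ℝ) < N + 1 by linarith)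
  have := Real.Gamma_pos_of_pos (show (0 : ℝ) < s + 1 by linarith)
  unfold bergmanWeight
  positivity

theorem eq_zero_of_bergmanSq_eq_zero {N : ℕ} {s : ℝ} (hs : -1 < s) {f : CSpace N → ℂ}
    (hf : HolOnBall f) (h : bergmanSq s f = 0) : f = 0 := by
  have hm : AEMeasurable f ((ballMeasure N).restrict (ball 0 1)) :=
    hf.1.continuousOn.aemeasurable measurableSet_ball
  have hw := (measurable_bergmanWeight N s).ennreal_ofReal
  replace h := (lintegral_eq_zero_iff' ((hm.enorm.pow_const 2).mul hw.aemeasurable)).1 h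
  have hcl : EqOn f 0 (ball (0 : CSpace N) 1) := by
    refine Measure.eqOn_open_of_ae_eq (μ := ballMeasure N) ?_ isOpen_ball
      hf.1.continuousOn continuousOn_const
    filter_upwards [h, ae_restrict_mem measurableSet_ball] with z hz hb
    have := bergmanWeight_pos hs hb
    simpa [this.not_ge] using hz
  funext z
  by_cases hz : z ∈ ball (0 : CSpace N) 1
  · exact hcl hz
  · exact hf.2 z hz

/-- `H²(B_N)` as a vector space of functions. -/
def hardySubmodule (N : ℕ) : Submodule ℂ (CSpace N → ℂ) where
  carrier := {f | HolOnBall f ∧ hardySq f < ∞}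
  add_mem' hf hg := ⟨hf.1.add hg.1, lt_top_of_le_sq (hardySq_add_le hf.1 hg.1) hf.2 hg.2⟩
  zero_mem' := ⟨HolOnBall.zero, by simp [hardySq_zero]⟩
  smul_mem' c f hf := ⟨hf.1.smul c, by
    rw [hardySq_smul]; exact ENNReal.mul_lt_top (by simp) hf.2⟩

/-- `A²_s(B_N)` as a vector space of functions. -/
def bergmanSubmodule (N : ℕ) (s : ℝ) : Submodule ℂ (CSpace N → ℂ) where
  carrier := {f | HolOnBall f ∧ bergmanSq s f < ∞}
  add_mem' hf hg := ⟨hf.1.add hg.1, lt_top_of_le_sq (bergmanSq_add_le s hf.1 hg.1) hf.2 hg.2⟩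
  zero_mem' := ⟨HolOnBall.zero, by simp [bergmanSq_zero]⟩
  smul_mem' c f hf := ⟨hf.1.smul c, by
    rw [bergmanSq_smul]; exact ENNReal.mul_lt_top (by simp) hf.2⟩

/-- The Hardy space `H²(B_N)`. It is a type of its own, so that its topology is the one of the
Hardy norm below and not the topology of pointwise convergence. -/
def HardySpace (N : ℕ) : Type := ↥(hardySubmodule N)

/-- The weighted Bergman space `A²_s(B_N)`, `s > -1`. -/
def BergmanSpace (N : ℕ) (s : ℝ) (_hs : -1 < s) : Type := ↥(bergmanSubmodule N s)

instance (N : ℕ) : AddCommGroup (HardySpace N) := inferInstanceAs (AddCommGroup ↥(hardySubmodule N))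
instance (N : ℕ) : Module ℂ (HardySpace N) := inferInstanceAs (Module ℂ ↥(hardySubmodule N))
instance (N : ℕ) : CoeFun (HardySpace N) fun _ => CSpace N → ℂ := ⟨fun f => f.1⟩

instance (N : ℕ) (s : ℝ) (hs : -1 < s) : AddCommGroup (BergmanSpace N s hs) :=
  inferInstanceAs (AddCommGroup ↥(bergmanSubmodule N s))
instance (N : ℕ) (s : ℝ) (hs : -1 < s) : Module ℂ (BergmanSpace N s hs) :=
  inferInstanceAs (Module ℂ ↥(bergmanSubmodule N s))
instance (N : ℕ) (s : ℝ) (hs : -1 < s) : CoeFun (BergmanSpace N s hs) fun _ => CSpace N → ℂ :=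
  ⟨fun f => f.1⟩

/-- The Hardy norm. -/
def hardyNorm (N : ℕ) [NeZero N] : AddGroupNorm (HardySpace N) where
  toFun f := √(hardySq f).toReal
  map_zero' := by
    change √(hardySq (0 : CSpace N → ℂ)).toReal = 0
    simp [hardySq_zero]
  add_le' f g := sqrt_toReal_le (hardySq_add_le f.2.1 g.2.1) f.2.2 g.2.2
  neg' f := by
    have h := hardySq_smul (-1) (f : CSpace N → ℂ)
    simp only [neg_smul, one_smul, enorm_neg, enorm_one, one_pow, one_mul] at h
    exact congrArg (fun a : ℝ≥0∞ => √a.toReal) h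
  eq_zero_of_map_eq_zero' f hf := by
    have h1 : (hardySq f).toReal = 0 := (Real.sqrt_eq_zero ENNReal.toReal_nonneg).1 hf
    have h2 : hardySq f = 0 := (ENNReal.toReal_eq_zero_iff _).1 h1 |>.resolve_right f.2.2.ne
    exact Subtype.ext (eq_zero_of_hardySq_eq_zero f.2.1 h2)

/-- The Bergman norm. -/
def bergmanNorm (N : ℕ) (s : ℝ) (hs : -1 < s) : AddGroupNorm (BergmanSpace N s hs) where
  toFun f := √(bergmanSq s f).toReal
  map_zero' := by
    change √(bergmanSq s (0 : CSpace N → ℂ)).toReal = 0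
    simp [bergmanSq_zero]
  add_le' f g := sqrt_toReal_le (bergmanSq_add_le s f.2.1 g.2.1) f.2.2 g.2.2
  neg' f := by
    have h := bergmanSq_smul s (-1) (f : CSpace N → ℂ)
    simp only [neg_smul, one_smul, enorm_neg, enorm_one, one_pow, one_mul] at h
    exact congrArg (fun a : ℝ≥0∞ => √a.toReal) h
  eq_zero_of_map_eq_zero' f hf := by
    have h1 : (bergmanSq s f).toReal = 0 := (Real.sqrt_eq_zero ENNReal.toReal_nonneg).1 hf
    have h2 : bergmanSq s f = 0 := (ENNReal.toReal_eq_zero_iff _).1 h1 |>.resolve_right f.2.2.ne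
    exact Subtype.ext (eq_zero_of_bergmanSq_eq_zero hs f.2.1 h2)

instance (N : ℕ) [NeZero N] : NormedAddCommGroup (HardySpace N) :=
  (hardyNorm N).toNormedAddCommGroup

instance (N : ℕ) (s : ℝ) (hs : -1 < s) : NormedAddCommGroup (BergmanSpace N s hs) :=
  (bergmanNorm N s hs).toNormedAddCommGroup

instance (N : ℕ) [NeZero N] : NormedSpace ℂ (HardySpace N) where
  norm_smul_le c f := by
    change √(hardySq (c • (f : CSpace N → ℂ))).toReal ≤ ‖c‖ * √(hardySq f).toReal
    rw [hardySq_smul, sqrt_toReal_smul]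

instance (N : ℕ) (s : ℝ) (hs : -1 < s) : NormedSpace ℂ (BergmanSpace N s hs) where
  norm_smul_le c f := by
    change √(bergmanSq s (c • (f : CSpace N → ℂ))).toReal ≤ ‖c‖ * √(bergmanSq s f).toReal
    rw [bergmanSq_smul, sqrt_toReal_smul]

/-- `φ` restricts to a holomorphic map of the unit ball into itself; its values outside the ball
are irrelevant. -/
def IsHolSelfMap {N : ℕ} (φ : CSpace N → CSpace N) : Prop :=
  DifferentiableOn ℂ φ (ball 0 1) ∧ MapsTo φ (ball 0 1) (ball 0 1)

/-- `C_φ` and `C_ψ` are bounded operators on `H²(B_N)` and `C_φ - C_ψ` is compact. -/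
def HardyCompactDifference {N : ℕ} [NeZero N] (φ ψ : CSpace N → CSpace N) : Prop :=
  ∃ Cφ Cψ : HardySpace N →L[ℂ] HardySpace N,
    (∀ f, ∀ z ∈ ball (0 : CSpace N) 1, Cφ f z = f (φ z)) ∧
    (∀ f, ∀ z ∈ ball (0 : CSpace N) 1, Cψ f z = f (ψ z)) ∧
    IsCompactOperator (Cφ - Cψ)

/-- `C_φ` and `C_ψ` are bounded operators on `A²_s(B_N)` and `C_φ - C_ψ` is compact. -/
def BergmanCompactDifference {N : ℕ} (s : ℝ) (hs : -1 < s) (φ ψ : CSpace N → CSpace N) : Prop :=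
  ∃ Cφ Cψ : BergmanSpace N s hs →L[ℂ] BergmanSpace N s hs,
    (∀ f, ∀ z ∈ ball (0 : CSpace N) 1, Cφ f z = f (φ z)) ∧
    (∀ f, ∀ z ∈ ball (0 : CSpace N) 1, Cψ f z = f (ψ z)) ∧
    IsCompactOperator (Cφ - Cψ)

/-- Restricted `ζ`-curves `Γ : [0,1) → B_N`. The orthogonal projection of `Γ` onto the complex line
through `ζ` is `γ(t) = ⟨Γ(t), ζ⟩ ζ`. -/
def IsRestrictedCurve {N : ℕ} (ζ : CSpace N) (Γ : ℝ → CSpace N) : Prop :=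
  let γ : ℝ → CSpace N := fun t => inner ℂ ζ (Γ t) • ζ
  ContinuousOn Γ (Ico 0 1) ∧ MapsTo Γ (Ico 0 1) (ball 0 1) ∧ Tendsto Γ (𝓝[<] 1) (𝓝 ζ) ∧
    Tendsto (fun t => ‖Γ t - γ t‖ ^ 2 / (1 - ‖γ t‖ ^ 2)) (𝓝[<] 1) (𝓝 0) ∧
    ∃ M : ℝ, ∀ t ∈ Ico (0 : ℝ) 1, ‖γ t - ζ‖ / (1 - ‖γ t‖) ≤ M

/-- `f` has restricted limit `L` at `ζ`. -/
def HasRestrictedLimit {N : ℕ} (f : CSpace N → ℂ) (ζ : CSpace N) (L : ℂ) : Prop :=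
  ∀ Γ : ℝ → CSpace N, IsRestrictedCurve ζ Γ → Tendsto (fun t => f (Γ t)) (𝓝[<] 1) (𝓝 L)

/-- `φ` has finite angular derivative at `ζ`: for some `η` on the sphere, the quotient
`⟨η - φ(z), η⟩ / ⟨ζ - z, ζ⟩` has a (finite) restricted limit at `ζ`. -/
def HasFiniteAngularDerivative {N : ℕ} (φ : CSpace N → CSpace N) (ζ : CSpace N) : Prop :=
  ∃ η ∈ sphere (0 : CSpace N) 1, ∃ L : ℂ,
    HasRestrictedLimit (fun z => inner ℂ η (η - φ z) / inner ℂ ζ (ζ - z)) ζ L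

/-- `d_φ(ζ) = liminf_{z → ζ} (1 - |φ(z)|) / (1 - |z|)`, with `z` unrestricted in the ball; the
value may be `+∞`. -/
def dilationCoeff {N : ℕ} (φ : CSpace N → CSpace N) (ζ : CSpace N) : EReal :=
  liminf (fun z => (((1 - ‖φ z‖) / (1 - ‖z‖) : ℝ) : EReal)) (𝓝[ball 0 1] ζ)

/-- `φ` has radial limit `η` at `ζ`. -/
def HasRadialLimit {N : ℕ} (φ : CSpace N → CSpace N) (ζ η : CSpace N) : Prop :=
  Tendsto (fun r : ℝ => φ (r • ζ)) (𝓝[<] 1) (𝓝 η)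

end

/-! Put α = N for H² and α = N + 1 + s for A²_s, and let T = C_φ - C_ψ. The test functions are
k_a(z) = (1 - ⟨z, a⟩)^(-m) with m a natural number and 2m > α. Two estimates of matching order drive
the argument: ‖k_a‖² ≤ C'(1 - |a|)^(α - 2m), and |f(w)|² ≤ C(1 - |w|)^(-α)‖f‖² for point
evaluations. Only the orders matter, so neither exact reproducing kernels nor adjoints enter, and an
integer m avoids branches of powers.

Compactness improves the second estimate. The normalized k_a form a bounded family, T maps it to a
totally bounded set, and each image is a bounded function. A finite net then gives |Tf(w)|² = o((1 -
|w|)^(-α)) uniformly over the family (`exists_forall_norm_sq_le_of_isCompactOperator`). Now take a =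
φ(rζ) and w = rζ. Where φ has finite angular derivative, (1 - |φ(rζ)|)/(1 - r) has a finite limit,
so k_a normalized has size of order (1 - r)^(-α/2) at a = φ(rζ), exactly the order that T must beat.
Hence k_a takes asymptotically equal values at φ(rζ) and ψ(rζ), that is, ((1 - |φ|²)/(1 - ⟨ψ, φ⟩))^m
→ 1 along the radius (`tendsto_kernel_ratio`).

Moduli alone finish the proof. From |1 - ⟨ψ, φ⟩| ~ 1 - |φ|² → 0 the two radial limits agree, and 1 -
|φ||ψ| ≤ |1 - ⟨ψ, φ⟩| gives d_ψ ≤ d_φ (`radialLimit_and_dilationCoeff_le`). In particular d_ψ is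
finite, so the roles can be exchanged.

The supporting facts are Julia's lemma and its radial consequence (`exists_julia`,
`julia_caratheodory_radial`), obtained from Schwarz–Pick in the ball. The norm of k_a comes from the
measure t^N of nonisotropic caps and the layer-cake formula. Point evaluations are bounded by the
sub-mean value property on anisotropic balls inside a spherical shell. -/

/-! ### Automorphisms of the ball and the Schwarz–Pick inequality -/

section BallAutomorphism

theorem one_sub_norm_sq_pos {E : Type*} [SeminormedAddCommGroup E] {z : E} (hz : ‖z‖ < 1) :
    0 < 1 - ‖z‖ ^ 2 := by
  nlinarith [norm_nonneg z]

variable {E : Type*} [NormedAddCommGroup E] [InnerProductSpace ℂ E]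

/-- The involutive automorphism of the unit ball that exchanges `0` and `w`. -/
noncomputable def ballInvolution (w z : E) : E :=
  (1 - inner ℂ w z)⁻¹ • ((1 - inner ℂ w z / (1 + (√(1 - ‖w‖ ^ 2) : ℝ))) • w
    - ((√(1 - ‖w‖ ^ 2) : ℝ) : ℂ) • z)

theorem norm_inner_lt_one {w z : E} (hw : ‖w‖ ≤ 1) (hz : ‖z‖ < 1) : ‖inner ℂ w z‖ < 1 := by
  have h := norm_inner_le_norm (𝕜 := ℂ) w z
  nlinarith [norm_nonneg z]

theorem one_sub_inner_ne_zero {w z : E} (hw : ‖w‖ ≤ 1) (hz : ‖z‖ < 1) :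
    1 - inner ℂ w z ≠ 0 := by
  intro h
  have h1 := norm_inner_lt_one hw hz
  rw [← sub_eq_zero.1 h] at h1
  simp at h1

/-- With s = √(1 - |w|²), the usual coefficient (1 - s)/|w|² of the projection part equals 1/(1 +
s), so w = 0 needs no separate case. After substituting |w|² = 1 - s², both sides are rational in s,
⟨z, w⟩ and |z|². -/
theorem one_sub_norm_sq_ballInvolution {w z : E} (hw : ‖w‖ < 1) (hz : ‖z‖ < 1) :
    (1 - ‖ballInvolution w z‖ ^ 2) * ‖1 - inner ℂ w z‖ ^ 2 =
      (1 - ‖w‖ ^ 2) * (1 - ‖z‖ ^ 2) := by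
  have hc := one_sub_inner_ne_zero hw.le hz
  have hA : ‖w‖ ^ 2 = 1 - √(1 - ‖w‖ ^ 2) ^ 2 := by
    rw [Real.sq_sqrt (one_sub_norm_sq_pos hw).le]; ring
  have hs0 : 0 ≤ √(1 - ‖w‖ ^ 2) := Real.sqrt_nonneg _
  unfold ballInvolution
  set s := √(1 - ‖w‖ ^ 2)
  set c : ℂ := inner ℂ w z with hcdef
  set k : ℂ := 1 - c / (1 + (s : ℂ)) with hk
  have hs1 : (1 + s) ≠ 0 := by positivity
  have hkr : k = 1 - c * (((1 + s)⁻¹ : ℝ) : ℂ) := by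
    rw [hk]; push_cast; rw [div_eq_mul_inv]
  have hv : ‖k • w - (s : ℂ) • z‖ ^ 2 =
      Complex.normSq k * ‖w‖ ^ 2 + s ^ 2 * ‖z‖ ^ 2
        - 2 * s * (k.re * c.re + k.im * c.im) := by
    rw [norm_sub_sq (𝕜 := ℂ), norm_smul, norm_smul, inner_smul_left, inner_smul_right, ← hcdef,
      mul_pow, mul_pow, Complex.sq_norm, Complex.norm_real, Real.norm_eq_abs, sq_abs]
    simp
    ring
  rw [norm_smul, mul_pow, norm_inv, hv, sub_mul, one_mul, mul_right_comm, ← mul_pow,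
    inv_mul_cancel₀ (norm_ne_zero_iff.2 hc), one_pow, one_mul, hA, hkr, Complex.sq_norm]
  simp [Complex.normSq_apply]
  field_simp
  ring

theorem norm_ballInvolution_lt_one {w z : E} (hw : ‖w‖ < 1) (hz : ‖z‖ < 1) :
    ‖ballInvolution w z‖ < 1 := by
  have h := one_sub_norm_sq_ballInvolution hw hz
  have h1 : 0 < (1 - ‖w‖ ^ 2) * (1 - ‖z‖ ^ 2) :=
    mul_pos (one_sub_norm_sq_pos hw) (one_sub_norm_sq_pos hz)
  rw [← h] at h1
  have h2 := pos_of_mul_pos_left h1 (by positivity)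
  nlinarith [norm_nonneg (ballInvolution w z)]

theorem ballInvolution_zero (w : E) : ballInvolution w 0 = w := by
  simp [ballInvolution]

theorem ballInvolution_self {w : E} (hw : ‖w‖ < 1) : ballInvolution w w = 0 := by
  have hA : (‖w‖ : ℂ) ^ 2 = 1 - ((√(1 - ‖w‖ ^ 2) : ℝ) : ℂ) ^ 2 := by
    rw [← Complex.ofReal_pow, ← Complex.ofReal_pow, Real.sq_sqrt (one_sub_norm_sq_pos hw).le]
    push_cast; ring
  have hs : (1 : ℂ) + ((√(1 - ‖w‖ ^ 2) : ℝ) : ℂ) ≠ 0 := by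
    norm_cast
    positivity
  rw [ballInvolution, inner_self_eq_norm_sq_to_K, ← sub_smul]
  simp only [Complex.coe_algebraMap, hA]
  convert smul_zero _
  convert zero_smul ℂ w
  field_simp
  ring

theorem ballInvolution_ballInvolution {w z : E} (hw : ‖w‖ < 1) (hz : ‖z‖ < 1) :
    ballInvolution w (ballInvolution w z) = z := by
  have hA : (‖w‖ : ℂ) ^ 2 = 1 - ((√(1 - ‖w‖ ^ 2) : ℝ) : ℂ) ^ 2 := by
    rw [← Complex.ofReal_pow, ← Complex.ofReal_pow, Real.sq_sqrt (one_sub_norm_sq_pos hw).le]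
    push_cast; ring
  have hs : (1 : ℂ) + ((√(1 - ‖w‖ ^ 2) : ℝ) : ℂ) ≠ 0 := by
    norm_cast
    positivity
  have hs' : ((√(1 - ‖w‖ ^ 2) : ℝ) : ℂ) ≠ 0 := by
    norm_cast
    exact (Real.sqrt_pos.2 (one_sub_norm_sq_pos hw)).ne'
  have hc := one_sub_inner_ne_zero hw.le hz
  have hin : 1 - inner ℂ w (ballInvolution w z) =
      ((√(1 - ‖w‖ ^ 2) : ℝ) : ℂ) ^ 2 / (1 - inner ℂ w z) := by
    rw [ballInvolution, inner_smul_right, inner_sub_right, inner_smul_right, inner_smul_right,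
      inner_self_eq_norm_sq_to_K]
    simp only [Complex.coe_algebraMap, hA]
    field_simp
    ring
  have hin' : inner ℂ w (ballInvolution w z) =
      1 - ((√(1 - ‖w‖ ^ 2) : ℝ) : ℂ) ^ 2 / (1 - inner ℂ w z) := by rw [← hin]; ring
  rw [ballInvolution, hin, hin', ballInvolution]
  set s : ℂ := ((√(1 - ‖w‖ ^ 2) : ℝ) : ℂ)
  set c : ℂ := inner ℂ w z
  have h1 : (s ^ 2 / (1 - c))⁻¹ • ((1 - (1 - s ^ 2 / (1 - c)) / (1 + s)) • w -
      s • (1 - c)⁻¹ • ((1 - c / (1 + s)) • w - s • z)) =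
      ((s ^ 2 / (1 - c))⁻¹ * ((1 - (1 - s ^ 2 / (1 - c)) / (1 + s)) -
        s * (1 - c)⁻¹ * (1 - c / (1 + s)))) • w +
      ((s ^ 2 / (1 - c))⁻¹ * (s * (1 - c)⁻¹ * s)) • z := by module
  rw [h1]
  have h2 : (s ^ 2 / (1 - c))⁻¹ * (s * (1 - c)⁻¹ * s) = 1 := by field_simp
  have h3 : (1 - (1 - s ^ 2 / (1 - c)) / (1 + s)) - s * (1 - c)⁻¹ * (1 - c / (1 + s)) = 0 := by
    field_simp
    ring
  rw [h2, h3]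
  simp

theorem differentiableOn_ballInvolution {w : E} (hw : ‖w‖ < 1) :
    DifferentiableOn ℂ (ballInvolution w) (ball 0 1) := by
  have hi : Differentiable ℂ fun z : E => inner ℂ w z := (innerSL ℂ w).differentiable
  unfold ballInvolution
  refine DifferentiableOn.smul (DifferentiableOn.inv ?_ ?_) ?_
  · exact (hi.const_sub 1).differentiableOn
  · intro z hz
    exact one_sub_inner_ne_zero hw.le (by simpa using hz)
  · have hk : Differentiable ℂ fun z : E => inner ℂ w z / (1 + (√(1 - ‖w‖ ^ 2) : ℝ)) := by
      simpa only [div_eq_mul_inv] using hi.mul_const _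
    exact ((hk.const_sub 1).smul_const w |>.sub
      (differentiable_id.const_smul _)).differentiableOn

/-- The Schwarz–Pick inequality for self-maps of the unit ball. -/
theorem schwarzPick_ball {φ : E → E} (hd : DifferentiableOn ℂ φ (ball 0 1))
    (hm : MapsTo φ (ball 0 1) (ball 0 1)) {z w : E} (hz : ‖z‖ < 1) (hw : ‖w‖ < 1) :
    ‖1 - inner ℂ (φ w) (φ z)‖ ^ 2 * ((1 - ‖w‖ ^ 2) * (1 - ‖z‖ ^ 2)) ≤
      ‖1 - inner ℂ w z‖ ^ 2 * ((1 - ‖φ w‖ ^ 2) * (1 - ‖φ z‖ ^ 2)) := by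
  have hφ : ∀ {x : E}, ‖x‖ < 1 → ‖φ x‖ < 1 := fun {x} hx => by
    simpa using hm (show x ∈ ball (0 : E) 1 by simpa using hx)
  have hmw : ∀ {v : E}, ‖v‖ < 1 → MapsTo (ballInvolution v) (ball 0 1) (ball 0 1) :=
    fun hv x hx => by
      simpa using norm_ballInvolution_lt_one hv (by simpa using hx)
  -- Conjugating φ by the involutions at w and φ(w) gives a self-map of the ball fixing 0. The
  -- Schwarz lemma for it, at the image of z, is the claim.
  have hle := Complex.norm_le_norm_of_mapsTo_ball
    (f := ballInvolution (φ w) ∘ φ ∘ ballInvolution w) (R := 1) (z := ballInvolution w z)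
    ((differentiableOn_ballInvolution (hφ hw)).comp
      (hd.comp (differentiableOn_ballInvolution hw) (hmw hw)) (hm.comp (hmw hw)))
    (((hmw (hφ hw)).comp (hm.comp (hmw hw))).mono_right ball_subset_closedBall)
    (by simp [ballInvolution_zero, ballInvolution_self (hφ hw)])
    (norm_ballInvolution_lt_one hw hz)
  simp only [Function.comp_apply, ballInvolution_ballInvolution hw hz] at hle
  rw [← one_sub_norm_sq_ballInvolution hw hz,
    ← one_sub_norm_sq_ballInvolution (hφ hw) (hφ hz)]
  have : ‖ballInvolution (φ w) (φ z)‖ ^ 2 ≤ ‖ballInvolution w z‖ ^ 2 := by gcongr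
  have h0 : 0 ≤ ‖1 - inner ℂ w z‖ ^ 2 * ‖1 - inner ℂ (φ w) (φ z)‖ ^ 2 := by positivity
  nlinarith

end BallAutomorphism

/-! ### Julia's lemma and radial approach -/

section JuliaCaratheodory

variable {N : ℕ}

theorem tendsto_radial {ζ : CSpace N} (hζ : ‖ζ‖ = 1) :
    Tendsto (fun r : ℝ => r • ζ) (𝓝[<] 1) (𝓝[ball 0 1] ζ) := by
  refine tendsto_nhdsWithin_iff.2 ⟨?_, ?_⟩
  · have : Tendsto (fun r : ℝ => r • ζ) (𝓝 1) (𝓝 ((1 : ℝ) • ζ)) :=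
      (continuous_id.smul continuous_const).tendsto 1
    rw [one_smul] at this
    exact this.mono_left nhdsWithin_le_nhds
  · filter_upwards [Ioo_mem_nhdsLT (zero_lt_one' ℝ)] with r hr
    simpa [norm_smul, hζ, abs_of_pos hr.1] using hr.2

theorem IsHolSelfMap.norm_lt_one {φ : CSpace N → CSpace N} (hφ : IsHolSelfMap φ) {z : CSpace N}
    (hz : ‖z‖ < 1) : ‖φ z‖ < 1 := by
  simpa using hφ.2 (show z ∈ ball (0 : CSpace N) 1 by simpa using hz)

theorem IsHolSelfMap.quotient_pos {φ : CSpace N → CSpace N} (hφ : IsHolSelfMap φ) {z : CSpace N}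
    (hz : ‖z‖ < 1) : 0 < (1 - ‖φ z‖) / (1 - ‖z‖) :=
  div_pos (sub_pos.2 (hφ.norm_lt_one hz)) (sub_pos.2 hz)

theorem dilationCoeff_nonneg {φ : CSpace N → CSpace N} (hφ : IsHolSelfMap φ) (ζ : CSpace N) :
    0 ≤ dilationCoeff φ ζ := by
  refine le_liminf_of_le (by isBoundedDefault) ?_
  filter_upwards [self_mem_nhdsWithin] with z hz
  exact_mod_cast (hφ.quotient_pos (by simpa using hz)).le

/-- Julia's lemma in the ball. -/
theorem exists_julia {φ : CSpace N → CSpace N} (hφ : IsHolSelfMap φ) {ζ : CSpace N}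
    (hζ : ‖ζ‖ = 1) {D : ℝ} (hD : dilationCoeff φ ζ = D) :
    ∃ η : CSpace N, ‖η‖ = 1 ∧ ∀ z, ‖z‖ < 1 →
      ‖1 - inner ℂ η (φ z)‖ ^ 2 * (1 - ‖z‖ ^ 2) ≤
        ‖1 - inner ℂ ζ z‖ ^ 2 * (D * (1 - ‖φ z‖ ^ 2)) := by
  -- The lower limit is nearly attained along some z_n → ζ. Schwarz–Pick between x and z_n then
  -- passes to the limit, with η a cluster point of φ(z_n).
  have hseq : ∀ n : ℕ, ∃ z : CSpace N, ‖z‖ < 1 ∧ dist z ζ < 1 / ((n : ℝ) + 1) ∧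
      (1 - ‖φ z‖) / (1 - ‖z‖) < D + 1 / ((n : ℝ) + 1) := by
    intro n
    have hn : (0 : ℝ) < 1 / ((n : ℝ) + 1) := by positivity
    have hf : ∃ᶠ z in 𝓝[ball 0 1] ζ, (((1 - ‖φ z‖) / (1 - ‖z‖) : ℝ) : EReal) <
        ((D + 1 / ((n : ℝ) + 1) : ℝ) : EReal) := by
      refine frequently_lt_of_liminf_lt (by isBoundedDefault) ?_
      change dilationCoeff φ ζ < _
      rw [hD]
      exact_mod_cast lt_add_of_pos_right D hn
    obtain ⟨z, h1, h2, h3⟩ := (hf.and_eventually ((eventually_mem_nhdsWithin (a := ζ)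
      (s := ball 0 1)).and (mem_nhdsWithin_of_mem_nhds (ball_mem_nhds ζ hn)))).exists
    exact ⟨z, by simpa using h2, h3, by exact_mod_cast h1⟩
  choose z hz1 hzd hzq using hseq
  have hzero : Tendsto (fun n : ℕ => 1 / ((n : ℝ) + 1)) atTop (𝓝 0) :=
    tendsto_one_div_add_atTop_nhds_zero_nat
  have hz : Tendsto z atTop (𝓝 ζ) :=
    tendsto_iff_dist_tendsto_zero.2 (squeeze_zero (fun _ => dist_nonneg) (fun n => (hzd n).le) hzero)
  obtain ⟨η, -, k, hk, hη⟩ := (isCompact_closedBall (0 : CSpace N) 1).tendsto_subseq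
    (x := fun n => φ (z n)) (fun n => by simpa using (hφ.norm_lt_one (hz1 n)).le)
  have hzk : Tendsto (z ∘ k) atTop (𝓝 ζ) := hz.comp hk.tendsto_atTop
  have hzerok := hzero.comp hk.tendsto_atTop
  have hnz : Tendsto (fun n => ‖z (k n)‖) atTop (𝓝 1) := by simpa [hζ] using hzk.norm
  have hlt : ∀ n, 1 - ‖φ (z n)‖ < (D + 1 / ((n : ℝ) + 1)) * (1 - ‖z n‖) := fun n =>
    (div_lt_iff₀ (sub_pos.2 (hz1 n))).1 (hzq n)
  have hη1 : ‖η‖ = 1 := by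
    have h0 : Tendsto (fun n => 1 - ‖φ (z (k n))‖) atTop (𝓝 0) := by
      refine squeeze_zero (fun n => (sub_pos.2 (hφ.norm_lt_one (hz1 _))).le)
        (fun n => (hlt (k n)).le) ?_
      simpa using (hzerok.const_add D).mul (hnz.const_sub 1)
    have h1 := tendsto_nhds_unique h0 (hη.norm.const_sub 1)
    linarith
  refine ⟨η, hη1, fun x hx => ?_⟩
  have hL : Tendsto (fun n => ‖1 - inner ℂ (φ (z (k n))) (φ x)‖ ^ 2 * (1 - ‖x‖ ^ 2)) atTop
      (𝓝 (‖1 - inner ℂ η (φ x)‖ ^ 2 * (1 - ‖x‖ ^ 2))) :=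
    (((hη.inner tendsto_const_nhds).const_sub 1).norm.pow 2).mul_const _
  have hR : Tendsto (fun n => ‖1 - inner ℂ (z (k n)) x‖ ^ 2 *
      (((D + 1 / ((k n : ℝ) + 1)) * (2 / (1 + ‖z (k n)‖))) * (1 - ‖φ x‖ ^ 2))) atTop
      (𝓝 (‖1 - inner ℂ ζ x‖ ^ 2 * (D * (1 - ‖φ x‖ ^ 2)))) := by
    have h2 : Tendsto (fun n => 2 / (1 + ‖z (k n)‖)) atTop (𝓝 1) := by
      have := (tendsto_const_nhds (x := (2 : ℝ))).div (hnz.const_add 1) (by norm_num)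
      norm_num at this
      exact this
    have h3 := ((hzerok.const_add D).mul h2)
    simp only [add_zero, mul_one] at h3
    exact (((hzk.inner tendsto_const_nhds).const_sub 1).norm.pow 2).mul (h3.mul_const _)
  refine le_of_tendsto_of_tendsto' hL hR fun n => ?_
  have hsp := schwarzPick_ball hφ.1 hφ.2 hx (hz1 (k n))
  have hpos := one_sub_norm_sq_pos (hz1 (k n))
  have hφz := hφ.norm_lt_one (hz1 (k n))
  have hl := hlt (k n)
  set q := D + 1 / ((k n : ℝ) + 1)
  set ρ := ‖z (k n)‖
  have hρ : 0 ≤ ρ := norm_nonneg _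
  -- Since 1 + |φ(z_n)| ≤ 2, the left side is at most 2(1 - |φ(z_n)|) ≤ 2q(1 - ρ). The correction
  -- 2/(1 + ρ) tends to 1, so the constant D survives in the limit.
  have hle : 1 - ‖φ (z (k n))‖ ^ 2 ≤ (q * (2 / (1 + ρ))) * (1 - ρ ^ 2) := by
    have : (q * (2 / (1 + ρ))) * (1 - ρ ^ 2) = 2 * (q * (1 - ρ)) := by
      field_simp
      ring
    rw [this]
    nlinarith [norm_nonneg (φ (z (k n)))]
  have hx' := one_sub_norm_sq_pos (hφ.norm_lt_one hx)
  refine le_of_mul_le_mul_right ?_ hpos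
  calc _ = ‖1 - inner ℂ (φ (z (k n))) (φ x)‖ ^ 2 * ((1 - ρ ^ 2) * (1 - ‖x‖ ^ 2)) := by ring
    _ ≤ _ := hsp
    _ ≤ ‖1 - inner ℂ (z (k n)) x‖ ^ 2 *
        (((q * (2 / (1 + ρ))) * (1 - ρ ^ 2)) * (1 - ‖φ x‖ ^ 2)) := by gcongr
    _ = _ := by ring

theorem norm_sub_sq_le_of_norm_le_one {a b : CSpace N} (ha : ‖a‖ ≤ 1) (hb : ‖b‖ ≤ 1) :
    ‖a - b‖ ^ 2 ≤ 2 * ‖1 - inner ℂ a b‖ := by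
  have h := Complex.re_le_norm (1 - inner ℂ a b)
  rw [norm_sub_sq (𝕜 := ℂ)]
  simp only [Complex.sub_re, Complex.one_re] at h
  simp only [RCLike.re_to_complex]
  nlinarith [norm_nonneg a, norm_nonneg b]

/-- Convergence of inner products to 1 forces |a - b| → 0 in the closed unit ball, by the preceding
inequality. It serves both for a = η constant and for a = φ(rζ), b = ψ(rζ). -/
theorem tendsto_of_tendsto_one_sub_inner {ι : Type*} {l : Filter ι} {a b : ι → CSpace N}
    {η : CSpace N} (ha : ∀ᶠ i in l, ‖a i‖ ≤ 1) (hb : ∀ᶠ i in l, ‖b i‖ ≤ 1)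
    (h : Tendsto (fun i => ‖1 - inner ℂ (a i) (b i)‖) l (𝓝 0)) (hlim : Tendsto a l (𝓝 η)) :
    Tendsto b l (𝓝 η) := by
  have h0 : Tendsto (fun i => ‖a i - b i‖ ^ 2) l (𝓝 0) := by
    refine squeeze_zero' (Eventually.of_forall fun _ => by positivity) ?_
      (by simpa using h.const_mul 2)
    filter_upwards [ha, hb] with i h1 h2 using norm_sub_sq_le_of_norm_le_one h1 h2
  have h1 : Tendsto (fun i => ‖a i - b i‖) l (𝓝 0) := by
    have := h0.sqrt
    simpa [Real.sqrt_sq] using this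
  simpa using hlim.sub (tendsto_zero_iff_norm_tendsto_zero.2 h1)

/-- The part of the Julia–Carathéodory theorem concerning radial approach. -/
theorem julia_caratheodory_radial {φ : CSpace N → CSpace N} (hφ : IsHolSelfMap φ) {ζ : CSpace N}
    (hζ : ‖ζ‖ = 1) (hfin : dilationCoeff φ ζ < ⊤) :
    ∃ D : ℝ, 0 < D ∧ dilationCoeff φ ζ = D ∧ (∃ η : CSpace N, ‖η‖ = 1 ∧ HasRadialLimit φ ζ η) ∧
      Tendsto (fun r : ℝ => (1 - ‖φ (r • ζ)‖) / (1 - r)) (𝓝[<] 1) (𝓝 D) := by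
  obtain ⟨D, hD⟩ : ∃ D : ℝ, dilationCoeff φ ζ = D :=
    ⟨_, (EReal.coe_toReal hfin.ne (bot_lt_iff_ne_bot.1
      ((EReal.bot_lt_zero).trans_le (dilationCoeff_nonneg hφ ζ)))).symm⟩
  obtain ⟨η, hη, hJ⟩ := exists_julia hφ hζ hD
  -- Julia's inequality at z = 0 has a positive left side.
  have hDpos : 0 < D := by
    have h := hJ 0 (by simp)
    have h0 := hφ.norm_lt_one (z := 0) (by simp)
    have h1 : 0 < ‖1 - inner ℂ η (φ 0)‖ :=
      norm_pos_iff.2 (one_sub_inner_ne_zero hη.le h0)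
    have h2 := one_sub_norm_sq_pos h0
    simp only [norm_zero, inner_zero_right, sub_zero, norm_one, one_pow, one_mul] at h
    norm_num at h
    have h3 : 0 < D * (1 - ‖φ 0‖ ^ 2) := lt_of_lt_of_le (by positivity) h
    exact pos_of_mul_pos_left h3 h2.le
  have hIoo : ∀ᶠ r : ℝ in 𝓝[<] 1, r ∈ Ioo (0 : ℝ) 1 := Ioo_mem_nhdsLT zero_lt_one
  have hnorm : ∀ r ∈ Ioo (0 : ℝ) 1, ‖r • ζ‖ = r := fun r hr => by
    simp [norm_smul, hζ, abs_of_pos hr.1]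
  have hball : ∀ r ∈ Ioo (0 : ℝ) 1, ‖φ (r • ζ)‖ < 1 := fun r hr =>
    hφ.norm_lt_one (by rw [hnorm r hr]; exact hr.2)
  have hJr : ∀ r ∈ Ioo (0 : ℝ) 1, ‖1 - inner ℂ η (φ (r • ζ))‖ ^ 2 * (1 + r) ≤
      (1 - r) * (D * (1 - ‖φ (r • ζ)‖ ^ 2)) := by
    intro r hr
    have h := hJ (r • ζ) (by rw [hnorm r hr]; exact hr.2)
    have hin : ‖1 - inner ℂ ζ (r • ζ)‖ = 1 - r := by
      have h1 : (inner ℂ ζ (r • ζ) : ℂ) = (r : ℂ) := by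
        rw [← Complex.coe_smul, inner_smul_right, inner_self_eq_norm_sq_to_K, hζ]
        simp
      rw [h1, ← Complex.ofReal_one, ← Complex.ofReal_sub, Complex.norm_real, Real.norm_eq_abs,
        abs_of_pos (sub_pos.2 hr.2)]
    rw [hin, hnorm r hr] at h
    have h1r : 0 < 1 - r := sub_pos.2 hr.2
    refine le_of_mul_le_mul_right ?_ h1r
    calc _ = ‖1 - inner ℂ η (φ (r • ζ))‖ ^ 2 * (1 - r ^ 2) := by ring
      _ ≤ _ := h
      _ = _ := by ring
  have hid : Tendsto (fun r : ℝ => r) (𝓝[<] 1) (𝓝 1) := tendsto_id.mono_left nhdsWithin_le_nhds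
  refine ⟨D, hDpos, hD, ⟨η, hη, ?_⟩, ?_⟩
  · refine tendsto_of_tendsto_one_sub_inner (a := fun _ => η) (Eventually.of_forall fun _ => hη.le)
      (hIoo.mono fun r hr => (hball r hr).le) ?_ tendsto_const_nhds
    have h0 : Tendsto (fun r : ℝ => ‖1 - inner ℂ η (φ (r • ζ))‖ ^ 2) (𝓝[<] 1) (𝓝 0) := by
      refine squeeze_zero' (Eventually.of_forall fun _ => by positivity)
        (g := fun r => (1 - r) * D) ?_ ?_
      · filter_upwards [hIoo] with r hr
        have h := hJr r hr
        have h2 : D * (1 - ‖φ (r • ζ)‖ ^ 2) ≤ D := by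
          nlinarith [sq_nonneg ‖φ (r • ζ)‖]
        calc _ ≤ ‖1 - inner ℂ η (φ (r • ζ))‖ ^ 2 * (1 + r) :=
              le_mul_of_one_le_right (by positivity) (by linarith [hr.1])
          _ ≤ _ := h
          _ ≤ _ := mul_le_mul_of_nonneg_left h2 (sub_pos.2 hr.2).le
      · simpa using (hid.const_sub 1).mul_const D
    have := h0.sqrt
    simpa [Real.sqrt_sq] using this
  -- The lower bound holds for every approach because D is the lower limit. The upper bound is
  -- Julia's inequality with |1 - ⟨φ, η⟩| ≥ 1 - |φ|: cancelling 1 - |φ| leaves a quotient of at most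
  -- 2D/(1 + r), which tends to D.
  · refine tendsto_order.2 ⟨fun x hx => ?_, fun x hx => ?_⟩
    · have hev : ∀ᶠ z in 𝓝[ball 0 1] ζ,
          (x : EReal) < (((1 - ‖φ z‖) / (1 - ‖z‖) : ℝ) : EReal) := by
        refine eventually_lt_of_lt_liminf ?_ (by isBoundedDefault)
        change _ < dilationCoeff φ ζ
        rw [hD]
        exact_mod_cast hx
      filter_upwards [(tendsto_radial hζ).eventually hev, hIoo] with r h hr
      rw [hnorm r hr] at h
      exact_mod_cast h
    · have hg : Tendsto (fun r : ℝ => D * 2 / (1 + r)) (𝓝[<] 1) (𝓝 D) := by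
        have := (tendsto_const_nhds (x := D * 2)).div (hid.const_add 1) (by norm_num)
        rwa [show D * 2 / (1 + 1) = D by ring] at this
      filter_upwards [hIoo, hg.eventually (gt_mem_nhds hx)] with r hr hlt
      refine lt_of_le_of_lt ?_ hlt
      have h := hJr r hr
      have hρ := hball r hr
      have hin : 1 - ‖φ (r • ζ)‖ ≤ ‖1 - inner ℂ η (φ (r • ζ))‖ := by
        have h1 := norm_inner_le_norm (𝕜 := ℂ) η (φ (r • ζ))
        have h2 := norm_sub_norm_le (1 : ℂ) (inner ℂ η (φ (r • ζ)))
        rw [norm_one] at h2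
        rw [hη, one_mul] at h1
        linarith
      set ρ := ‖φ (r • ζ)‖
      have hρ0 : 0 ≤ ρ := norm_nonneg _
      have h1 : (1 - ρ) ^ 2 * (1 + r) ≤ (1 - r) * (D * (1 - ρ ^ 2)) := by
        refine le_trans ?_ h
        have : 0 ≤ 1 - ρ := by linarith
        have := hr.1
        gcongr
      have h2 : (1 - ρ) * (1 + r) ≤ (1 - r) * (D * (1 + ρ)) := by
        refine le_of_mul_le_mul_left ?_ (sub_pos.2 hρ)
        calc _ = (1 - ρ) ^ 2 * (1 + r) := by ring
          _ ≤ _ := h1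
          _ = _ := by ring
      rw [div_le_div_iff₀ (sub_pos.2 hr.2) (by linarith [hr.1])]
      have h3 : (1 - r) * (D * (1 + ρ)) ≤ (1 - r) * (D * 2) := by
        have := hr.2
        gcongr
        linarith
      linarith

/-- A finite angular derivative forces a finite dilation coefficient. -/
theorem HasFiniteAngularDerivative.dilationCoeff_lt_top {φ : CSpace N → CSpace N}
    {ζ : CSpace N} (hζ : ‖ζ‖ = 1) (h : HasFiniteAngularDerivative φ ζ) :
    dilationCoeff φ ζ < ⊤ := by
  obtain ⟨η, hη, L, hL⟩ := h
  have hη1 : ‖η‖ = 1 := by simpa using hη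
  have hself : ∀ r : ℝ, (inner ℂ ζ (r • ζ) : ℂ) = (r : ℂ) := fun r => by
    rw [← Complex.coe_smul, inner_smul_right, inner_self_eq_norm_sq_to_K, hζ]
    simp
  have hγ : ∀ t : ℝ, (inner ℂ ζ (t • ζ) : ℂ) • ζ = t • ζ := fun t => by
    rw [hself, Complex.coe_smul]
  -- The radius is its own projection, so the first quotient vanishes and the second is identically
  -- 1. The bound on the angular quotient along this curve bounds (1 - |φ|)/(1 - |z|) frequently
  -- near ζ.
  have hcurve : IsRestrictedCurve ζ fun t : ℝ => t • ζ := by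
    refine ⟨by fun_prop, fun t ht => ?_, (tendsto_radial hζ).mono_right nhdsWithin_le_nhds, ?_,
      1, fun t ht => ?_⟩
    · simpa [norm_smul, hζ, abs_of_nonneg ht.1] using ht.2
    · have h0 : ∀ t : ℝ, ‖t • ζ - (inner ℂ ζ (t • ζ) : ℂ) • ζ‖ = 0 := fun t => by
        rw [hγ, sub_self, norm_zero]
      simp only [h0]
      simp
    · have h1 : t • ζ - ζ = (t - 1) • ζ := by module
      simp only [hγ]
      rw [h1, norm_smul, norm_smul, hζ, Real.norm_eq_abs, Real.norm_eq_abs,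
        abs_of_nonneg ht.1, abs_of_neg (sub_neg.2 ht.2), mul_one, mul_one, neg_sub,
        div_self (sub_pos.2 ht.2).ne']
  have hlim := (hL _ hcurve).norm
  have hev : ∀ᶠ r : ℝ in 𝓝[<] 1,
      (1 - ‖φ (r • ζ)‖) / (1 - ‖r • ζ‖) ≤ ‖L‖ + 1 := by
    filter_upwards [hlim.eventually (gt_mem_nhds (lt_add_one ‖L‖)),
      Ioo_mem_nhdsLT (zero_lt_one' ℝ)] with r h1 hr
    refine le_trans ?_ h1.le
    have hden : ‖inner ℂ ζ (ζ - r • ζ)‖ = 1 - r := by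
      rw [inner_sub_right, hself, inner_self_eq_norm_sq_to_K, hζ]
      simp only [RCLike.ofReal_one, one_pow]
      rw [← Complex.ofReal_one, ← Complex.ofReal_sub, Complex.norm_real, Real.norm_eq_abs,
        abs_of_pos (sub_pos.2 hr.2)]
    have hnum : 1 - ‖φ (r • ζ)‖ ≤ ‖inner ℂ η (η - φ (r • ζ))‖ := by
      rw [inner_sub_right, inner_self_eq_norm_sq_to_K, hη1]
      have h1 := norm_inner_le_norm (𝕜 := ℂ) η (φ (r • ζ))
      have h2 := norm_sub_norm_le (1 : ℂ) (inner ℂ η (φ (r • ζ)))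
      rw [norm_one] at h2
      rw [hη1, one_mul] at h1
      simp only [RCLike.ofReal_one, one_pow]
      linarith
    rw [norm_div, hden, norm_smul, hζ, Real.norm_eq_abs, abs_of_pos hr.1, mul_one]
    have := sub_pos.2 hr.2
    gcongr
  have hfreq : ∃ᶠ z in 𝓝[ball 0 1] ζ,
      (((1 - ‖φ z‖) / (1 - ‖z‖) : ℝ) : EReal) ≤ ((‖L‖ + 1 : ℝ) : EReal) :=
    (tendsto_radial hζ).frequently (hev.frequently.mono fun r hr => by exact_mod_cast hr)
  exact (liminf_le_of_frequently_le hfreq (by isBoundedDefault)).trans_lt (EReal.coe_lt_top _)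

end JuliaCaratheodory

/-! ### Polar coordinates for the normalized measures -/

section Polar

variable {N : ℕ} [NeZero N]

theorem finrank_real_cspace (N : ℕ) : Module.finrank ℝ (CSpace N) = 2 * N := by
  rw [← Module.finrank_mul_finrank ℝ ℂ (CSpace N)]
  simp [Complex.finrank_real_complex]

theorem volume_unitBall_ne_zero (N : ℕ) : (volume : Measure (CSpace N)) (ball 0 1) ≠ 0 :=
  (measure_ball_pos _ _ one_pos).ne'

theorem volume_unitBall_ne_top (N : ℕ) : (volume : Measure (CSpace N)) (ball 0 1) ≠ ∞ :=
  measure_ball_lt_top.ne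

theorem toSphere_univ_cspace (N : ℕ) : (volume : Measure (CSpace N)).toSphere univ =
    (2 * N : ℕ) * (volume : Measure (CSpace N)) (ball 0 1) := by
  rw [Measure.toSphere_apply_univ, finrank_real_cspace]

theorem sphereMeasure_univ : sphereMeasure N univ = 1 := by
  rw [sphereMeasure, Measure.smul_apply, smul_eq_mul]
  refine ENNReal.inv_mul_cancel ?_ (measure_ne_top _ _)
  rw [toSphere_univ_cspace]
  refine mul_ne_zero ?_ (volume_unitBall_ne_zero N)
  exact_mod_cast (mul_ne_zero two_ne_zero (NeZero.ne N))

theorem lintegral_polar_toSphere {F : CSpace N → ℝ≥0∞} (hF : Measurable F) :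
    ∫⁻ z, F z = ∫⁻ r in Ioi (0 : ℝ), ENNReal.ofReal (r ^ (2 * N - 1)) *
      ∫⁻ ξ : sphere (0 : CSpace N) 1, F (r • (ξ : CSpace N))
        ∂(volume : Measure (CSpace N)).toSphere := by
  have hmp := (volume : Measure (CSpace N)).measurePreserving_homeomorphUnitSphereProd
  have hG : Measurable fun p : sphere (0 : CSpace N) 1 × Ioi (0 : ℝ) =>
      F ((p.2 : ℝ) • (p.1 : CSpace N)) := hF.comp (by fun_prop)
  have hnull : (volume : Measure (CSpace N)).restrict {(0 : CSpace N)}ᶜ = volume :=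
    restrict_compl_singleton 0
  calc ∫⁻ z, F z = ∫⁻ z in {(0 : CSpace N)}ᶜ, F z := by rw [hnull]
    _ = ∫⁻ z : ({(0 : CSpace N)}ᶜ : Set (CSpace N)), F z ∂((volume : Measure (CSpace N)).comap Subtype.val) :=
        (lintegral_subtype_comap (measurableSet_singleton _).compl F).symm
    _ = ∫⁻ z : ({(0 : CSpace N)}ᶜ : Set (CSpace N)),
          (fun p : sphere (0 : CSpace N) 1 × Ioi (0 : ℝ) => F ((p.2 : ℝ) • (p.1 : CSpace N)))
            (homeomorphUnitSphereProd (CSpace N) z) ∂((volume : Measure (CSpace N)).comap Subtype.val) := by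
        refine lintegral_congr fun z => ?_
        have hz : ‖(z : CSpace N)‖ ≠ 0 := norm_ne_zero_iff.2 z.2
        simp [smul_smul, hz]
    _ = ∫⁻ p, F ((p.2 : ℝ) • (p.1 : CSpace N)) ∂((volume : Measure (CSpace N)).toSphere.prod
          (Measure.volumeIoiPow (Module.finrank ℝ (CSpace N) - 1))) :=
        hmp.lintegral_comp hG
    _ = ∫⁻ r : Ioi (0 : ℝ), ∫⁻ ξ : sphere (0 : CSpace N) 1, F ((r : ℝ) • (ξ : CSpace N))
          ∂(volume : Measure (CSpace N)).toSphere
          ∂(Measure.volumeIoiPow (Module.finrank ℝ (CSpace N) - 1)) :=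
        lintegral_prod_symm' _ hG
    _ = _ := by
        rw [Measure.volumeIoiPow, finrank_real_cspace,
          lintegral_withDensity_eq_lintegral_mul₀ (by fun_prop)
            hG.lintegral_prod_left'.aemeasurable]
        exact lintegral_subtype_comap measurableSet_Ioi fun r : ℝ =>
          ENNReal.ofReal (r ^ (2 * N - 1)) *
          ∫⁻ ξ : sphere (0 : CSpace N) 1, F (r • (ξ : CSpace N))
            ∂(volume : Measure (CSpace N)).toSphere

/-- Integration in polar coordinates with respect to the normalized measures. -/
theorem lintegral_polar {F : CSpace N → ℝ≥0∞} (hF : Measurable F) :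
    ∫⁻ z, F z ∂(ballMeasure N) = (2 * N : ℕ) * ∫⁻ r in Ioi (0 : ℝ),
      ENNReal.ofReal (r ^ (2 * N - 1)) *
        ∫⁻ ξ : sphere (0 : CSpace N) 1, F (r • (ξ : CSpace N)) ∂(sphereMeasure N) := by
  have h2N : ((2 * N : ℕ) : ℝ≥0∞) ≠ 0 := by
    exact_mod_cast (mul_ne_zero two_ne_zero (NeZero.ne N))
  have hS0 : (volume : Measure (CSpace N)).toSphere univ ≠ 0 := by
    rw [toSphere_univ_cspace]
    exact mul_ne_zero h2N (volume_unitBall_ne_zero N)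
  have h1 : ∀ r : ℝ, ∫⁻ ξ : sphere (0 : CSpace N) 1, F (r • (ξ : CSpace N)) ∂(sphereMeasure N) =
      ((volume : Measure (CSpace N)).toSphere univ)⁻¹ *
      ∫⁻ ξ : sphere (0 : CSpace N) 1, F (r • (ξ : CSpace N))
        ∂(volume : Measure (CSpace N)).toSphere := fun r => by
    rw [sphereMeasure, lintegral_smul_measure, smul_eq_mul]
  simp only [h1, mul_left_comm (ENNReal.ofReal _)]
  -- The total surface mass is 2N times the volume of the ball; this ratio is the factor 2N left
  -- after both normalizations.
  rw [lintegral_const_mul' _ _ (ENNReal.inv_ne_top.2 hS0), ← lintegral_polar_toSphere hF,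
    ballMeasure, lintegral_smul_measure, smul_eq_mul, toSphere_univ_cspace,
    ENNReal.mul_inv (Or.inl h2N) (Or.inl (ENNReal.natCast_ne_top _)), ← mul_assoc, ← mul_assoc,
    ENNReal.mul_inv_cancel h2N (ENNReal.natCast_ne_top _), one_mul]

end Polar

/-! ### Anisotropic dilations and their determinants -/

section Anisotropic

variable {N : ℕ}

/-- The linear map that acts as `τ²` on the complex line spanned by the unit vector `e` and as
`τ` on its orthogonal complement. -/
noncomputable def anisoMap (e : CSpace N) (τ : ℝ) : CSpace N →ₗ[ℂ] CSpace N :=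
  (τ : ℂ) • LinearMap.transvection (((τ : ℂ) - 1) • (innerSL ℂ e).toLinearMap) e

theorem anisoMap_apply (e u : CSpace N) (τ : ℝ) :
    anisoMap e τ u = (τ : ℂ) • (u + (((τ : ℂ) - 1) * inner ℂ e u) • e) := by
  simp [anisoMap, LinearMap.transvection]

theorem inner_anisoMap {e : CSpace N} (he : ‖e‖ = 1) (τ : ℝ) (u : CSpace N) :
    inner ℂ e (anisoMap e τ u) = (τ : ℂ) ^ 2 * inner ℂ e u := by
  rw [anisoMap_apply, inner_smul_right, inner_add_right, inner_smul_right,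
    inner_self_eq_norm_sq_to_K, he]
  simp
  ring

theorem anisoMap_anisoMap_inv {e : CSpace N} (he : ‖e‖ = 1) {τ : ℝ} (hτ : τ ≠ 0) (u : CSpace N) :
    anisoMap e τ (anisoMap e τ⁻¹ u) = u := by
  have hτ' : (τ : ℂ) ≠ 0 := by exact_mod_cast hτ
  rw [anisoMap_apply, inner_anisoMap he, anisoMap_apply, Complex.ofReal_inv]
  have : (τ : ℂ) • ((τ : ℂ)⁻¹ • (u + (((τ : ℂ)⁻¹ - 1) * inner ℂ e u) • e) +
      (((τ : ℂ) - 1) * ((τ : ℂ)⁻¹ ^ 2 * inner ℂ e u)) • e) =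
      ((τ : ℂ) * (τ : ℂ)⁻¹) • u + (((τ : ℂ) * (τ : ℂ)⁻¹ * ((τ : ℂ)⁻¹ - 1) +
        (τ : ℂ) * ((τ : ℂ) - 1) * (τ : ℂ)⁻¹ ^ 2) * inner ℂ e u) • e := by
    module
  rw [this, mul_inv_cancel₀ hτ']
  have h0 : (1 * ((τ : ℂ)⁻¹ - 1) + (τ : ℂ) * ((τ : ℂ) - 1) * (τ : ℂ)⁻¹ ^ 2) = 0 := by
    field_simp
    ring
  rw [h0]
  simp

theorem norm_sq_anisoMap {e : CSpace N} (he : ‖e‖ = 1) (τ : ℝ) (u : CSpace N) :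
    ‖anisoMap e τ u‖ ^ 2 = τ ^ 2 * (‖u‖ ^ 2 + (τ ^ 2 - 1) * ‖inner ℂ e u‖ ^ 2) := by
  have h1 : inner ℂ u ((((τ : ℂ) - 1) * inner ℂ e u) • e) =
      (((τ - 1) * ‖inner ℂ e u‖ ^ 2 : ℝ) : ℂ) := by
    rw [inner_smul_right, mul_assoc, ← inner_conj_symm u e, Complex.mul_conj,
      Complex.normSq_eq_norm_sq]
    push_cast
    ring
  have h2 : ‖(τ : ℂ) - 1‖ ^ 2 = (τ - 1) ^ 2 := by
    rw [← Complex.ofReal_one, ← Complex.ofReal_sub, Complex.norm_real, Real.norm_eq_abs, sq_abs]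
  rw [anisoMap_apply, norm_smul, mul_pow, Complex.norm_real, Real.norm_eq_abs, sq_abs,
    norm_add_sq (𝕜 := ℂ), h1, norm_smul, he, norm_mul, mul_one, mul_pow, h2]
  simp only [RCLike.re_to_complex, Complex.ofReal_re]
  ring

/-- The scalar τ contributes τ^N and the transvection 1 + (τ - 1) = τ; the real determinant is the
squared modulus of the complex one. For τ = √t this is t^(N+1), the volume order of a nonisotropic
ball of size t. -/
theorem det_anisoMap {e : CSpace N} (he : ‖e‖ = 1) (τ : ℝ) :
    LinearMap.det ((anisoMap e τ).restrictScalars ℝ) = (τ ^ (N + 1)) ^ 2 := by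
  have hd : LinearMap.det (anisoMap e τ) = (τ : ℂ) ^ (N + 1) := by
    rw [anisoMap, LinearMap.det_smul, LinearMap.transvection.det]
    simp [he]
    ring
  rw [LinearMap.det_restrictScalars, hd, Algebra.norm_complex_apply, ← Complex.ofReal_pow,
    Complex.normSq_ofReal]
  ring

theorem volume_image_anisoMap {e : CSpace N} (he : ‖e‖ = 1) (τ : ℝ) (S : Set (CSpace N)) :
    volume (anisoMap e τ '' S) = ENNReal.ofReal ((τ ^ (N + 1)) ^ 2) * volume S := by
  have := Measure.addHaar_image_linearMap volume ((anisoMap e τ).restrictScalars ℝ) S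
  rw [det_anisoMap he, abs_of_nonneg (by positivity)] at this
  exact this

end Anisotropic

/-! ### Surface measure of nonisotropic caps -/

section Cap

variable {N : ℕ}

theorem measurable_norm_one_sub_inner (κ : ℂ) (e : CSpace N) :
    Measurable fun z : CSpace N => ‖1 - κ * inner ℂ e z‖ := by
  have : Continuous fun z : CSpace N => inner ℂ e z := by fun_prop
  exact (continuous_const.sub (continuous_const.mul this)).norm.measurable

/-- The hypothesis already forces 1 - κ ≤ t, and 1 - l = (1 - κl) - (1 - κ)l. Thus caps with an
interior pole κe reduce to caps at e of twice the size, uniformly in κ. -/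
theorem norm_one_sub_le_of_norm_one_sub_mul_le {κ t : ℝ} (hκ0 : 0 ≤ κ) (hκ1 : κ ≤ 1) {l : ℂ}
    (hl : ‖l‖ ≤ 1) (h : ‖1 - κ * l‖ ≤ t) : ‖1 - l‖ ≤ 2 * t := by
  have h1 : 1 - κ ≤ t := by
    have h2 := norm_sub_norm_le (1 : ℂ) (κ * l)
    rw [norm_one, norm_mul, Complex.norm_real, Real.norm_eq_abs, abs_of_nonneg hκ0] at h2
    nlinarith
  have h3 : 1 - l = (1 - κ * l) - ((1 - κ : ℝ) : ℂ) * l := by push_cast; ring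
  rw [h3]
  refine (norm_sub_le _ _).trans ?_
  rw [norm_mul, Complex.norm_real, Real.norm_eq_abs, abs_of_nonneg (sub_nonneg.2 hκ1)]
  nlinarith [norm_nonneg l]

/-- Nonisotropic caps of size `t` lie, after thickening, in an anisotropic ball. -/
theorem cap_sector_subset {e : CSpace N} (he : ‖e‖ = 1) {κ t : ℝ} (hκ0 : 0 ≤ κ) (hκ1 : κ ≤ 1)
    (ht : 0 < t) {r : ℝ} (hr : r ∈ Ioo (1 - t) 1) (hr0 : 0 < r) {ξ : CSpace N} (hξ : ‖ξ‖ = 1)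
    (h : ‖1 - κ * inner ℂ e ξ‖ ≤ t) :
    r • ξ ∈ (fun u => e + u) '' (anisoMap e √t '' ball 0 4) := by
  have hτ : 0 < √t := Real.sqrt_pos.2 ht
  have hτ2 : √t ^ 2 = t := Real.sq_sqrt ht.le
  refine ⟨r • ξ - e, ⟨anisoMap e (√t)⁻¹ (r • ξ - e), ?_, anisoMap_anisoMap_inv he hτ.ne' _⟩,
    by simp⟩
  have hl : ‖inner ℂ e ξ‖ ≤ 1 := by
    have := norm_inner_le_norm (𝕜 := ℂ) e ξ
    rwa [he, hξ, one_mul] at this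
  have h2 := norm_one_sub_le_of_norm_one_sub_mul_le hκ0 hκ1 hl h
  have hin : inner ℂ e (r • ξ - e) = (r : ℂ) * inner ℂ e ξ - 1 := by
    rw [inner_sub_right, ← Complex.coe_smul, inner_smul_right, inner_self_eq_norm_sq_to_K, he]
    simp
  -- The bound is 2t from the cap plus 1 - r < t from the thickening.
  have h3 : ‖inner ℂ e (r • ξ - e)‖ ≤ 3 * t := by
    have h4 : (r : ℂ) * inner ℂ e ξ - 1 = -((1 - inner ℂ e ξ) + ((1 - r : ℝ) : ℂ) * inner ℂ e ξ) := by
      push_cast; ring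
    rw [hin, h4, norm_neg]
    refine (norm_add_le _ _).trans ?_
    rw [norm_mul, Complex.norm_real, Real.norm_eq_abs, abs_of_pos (sub_pos.2 hr.2)]
    nlinarith [hr.1, hr.2, norm_nonneg (inner ℂ e ξ : ℂ)]
  -- Here |rξ - e|² = 1 + r² - 2 Re⟨rξ, e⟩ ≤ 2(1 - Re⟨rξ, e⟩) ≤ 6t.
  have h5 : ‖r • ξ - e‖ ^ 2 ≤ 6 * t := by
    have hre : -(inner ℂ e (r • ξ - e) : ℂ).re ≤ 3 * t :=
      (neg_le_abs _).trans ((Complex.abs_re_le_norm _).trans h3)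
    rw [hin] at hre
    simp only [Complex.sub_re, Complex.one_re] at hre
    have hn : ‖r • ξ‖ = r := by rw [norm_smul, hξ, Real.norm_eq_abs, abs_of_pos hr0, mul_one]
    rw [norm_sub_rev, norm_sub_sq (𝕜 := ℂ), he, hn, ← Complex.coe_smul, inner_smul_right]
    simp only [RCLike.re_to_complex]
    nlinarith [hr.2]
  -- The inverse dilation turns the two bounds into 6 + 9 = 15 < 4², which explains the radius 4.
  have h6 : ‖anisoMap e (√t)⁻¹ (r • ξ - e)‖ ^ 2 ≤ 15 := by
    rw [norm_sq_anisoMap he, inv_pow, hτ2]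
    have h7 : ‖inner ℂ e (r • ξ - e)‖ ^ 2 ≤ (3 * t) ^ 2 := by gcongr
    have h8 : t⁻¹ * t = 1 := inv_mul_cancel₀ ht.ne'
    have h9 : 0 < t⁻¹ := inv_pos.2 ht
    calc _ ≤ t⁻¹ * (‖r • ξ - e‖ ^ 2 + t⁻¹ * ‖inner ℂ e (r • ξ - e)‖ ^ 2) := by
          gcongr
          linarith
      _ ≤ t⁻¹ * (6 * t + t⁻¹ * (3 * t) ^ 2) := by gcongr
      _ = (t⁻¹ * t) * 6 + (t⁻¹ * t) ^ 2 * 9 := by ring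
      _ = 15 := by rw [h8]; norm_num
  have : ‖anisoMap e (√t)⁻¹ (r • ξ - e)‖ < 4 := by
    nlinarith [norm_nonneg (anisoMap e (√t)⁻¹ (r • ξ - e))]
  simpa using this

/-- The surface measure of a nonisotropic cap of size `t` is at most a multiple of `t ^ N`. -/
theorem exists_sphereMeasure_cap_le (N : ℕ) [NeZero N] : ∃ C : ℝ, 0 < C ∧ ∀ (e : CSpace N),
    ‖e‖ = 1 → ∀ κ : ℝ, 0 ≤ κ → κ ≤ 1 → ∀ t : ℝ, 0 < t →
      sphereMeasure N {ξ | ‖1 - κ * inner ℂ e (ξ : CSpace N)‖ ≤ t} ≤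
        ENNReal.ofReal (C * t ^ N) := by
  have hN : 0 < N := Nat.pos_of_ne_zero (NeZero.ne N)
  set K : ℝ := (ballMeasure N (ball 0 4)).toReal with hK
  have hKtop : ballMeasure N (ball 0 4) ≠ ∞ := by
    rw [ballMeasure, Measure.smul_apply, smul_eq_mul]
    exact ENNReal.mul_ne_top (ENNReal.inv_ne_top.2 (volume_unitBall_ne_zero N))
      measure_ball_lt_top.ne
  have hK0 : 0 ≤ K := ENNReal.toReal_nonneg
  refine ⟨2 ^ N + 2 ^ (2 * N - 1) * K, by positivity, fun e he κ hκ0 hκ1 t ht => ?_⟩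
  -- For t ≥ 1/2 the total mass 1 ≤ (2t)^N suffices. For t < 1/2 the shell 1 - t < r < 1 stays in r
  -- > 1/2, which bounds the polar density below.
  rcases le_or_gt (1 / 2) t with h2 | h2
  · calc _ ≤ sphereMeasure N univ := measure_mono (subset_univ _)
      _ = ENNReal.ofReal 1 := by rw [sphereMeasure_univ, ENNReal.ofReal_one]
      _ ≤ _ := by
        refine ENNReal.ofReal_le_ofReal ?_
        have h3 : (1 : ℝ) ≤ (2 * t) ^ N := one_le_pow₀ (by linarith)
        rw [mul_pow] at h3
        have h4 : 0 ≤ 2 ^ (2 * N - 1) * K * t ^ N := by positivity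
        linarith
  set Q : Set (sphere (0 : CSpace N) 1) := {ξ | ‖1 - κ * inner ℂ e (ξ : CSpace N)‖ ≤ t} with hQ
  -- The sector over the cap has volume at least (1/2)^(2N-1) t σ(Q) by polar coordinates, and at
  -- most K t^(N+1) since it lies in an anisotropic ball. Division by t gives the order t^N.
  set S : Set (CSpace N) := {z | ‖z‖ ∈ Ioo (1 - t) 1 ∧
    ‖1 - κ * inner ℂ e ((‖z‖⁻¹ : ℝ) • z)‖ ≤ t} with hS
  have hinv : Measurable fun z : CSpace N => (‖z‖⁻¹ : ℝ) • z :=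
    measurable_norm.inv.smul measurable_id
  have hSm : MeasurableSet S :=
    (measurable_norm measurableSet_Ioo).inter
      (measurableSet_le ((measurable_norm_one_sub_inner κ e).comp hinv) measurable_const)
  have hQm : MeasurableSet Q :=
    measurableSet_le ((measurable_norm_one_sub_inner κ e).comp measurable_subtype_coe)
      measurable_const
  have hmem : ∀ r ∈ Ioo (1 - t) 1, ∀ ξ : sphere (0 : CSpace N) 1,
      (r • (ξ : CSpace N) ∈ S ↔ ξ ∈ Q) := by
    intro r hr ξ
    have hr0 : 0 < r := by linarith [hr.1]
    have hn : ‖r • (ξ : CSpace N)‖ = r := by simp [norm_smul, abs_of_pos hr0]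
    simp only [hS, hQ, mem_ofPred_eq, hn, hr, true_and, smul_smul, inv_mul_cancel₀ hr0.ne',
      one_smul]
  have hsub : S ⊆ (fun u => e + u) '' (anisoMap e √t '' ball 0 4) := by
    intro z hz
    have hz0 : 0 < ‖z‖ := by linarith [hz.1.1]
    have := cap_sector_subset he hκ0 hκ1 ht hz.1 hz0
      (ξ := (‖z‖⁻¹ : ℝ) • z) (by simp [norm_smul, hz0.ne']) hz.2
    rwa [smul_smul, mul_inv_cancel₀ hz0.ne', one_smul] at this
  have hupper : ballMeasure N S ≤ ENNReal.ofReal (t ^ (N + 1) * K) := by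
    refine (measure_mono hsub).trans ?_
    rw [ENNReal.ofReal_mul (by positivity), hK, ENNReal.ofReal_toReal hKtop, ballMeasure,
      Measure.smul_apply, Measure.smul_apply, image_add_left, measure_preimage_add,
      volume_image_anisoMap he, ← pow_mul, mul_comm (N + 1) 2, pow_mul, Real.sq_sqrt ht.le,
      smul_eq_mul, smul_eq_mul, mul_left_comm]
  have hlower : ENNReal.ofReal ((1 / 2) ^ (2 * N - 1) * t) * sphereMeasure N Q ≤
      ballMeasure N S := by
    rw [← lintegral_indicator_one hSm, lintegral_polar (measurable_one.indicator hSm)]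
    have h2N : (1 : ℝ≥0∞) ≤ (2 * N : ℕ) := by exact_mod_cast (by omega : 1 ≤ 2 * N)
    refine le_trans ?_ (le_mul_of_one_le_left bot_le h2N)
    calc _ = ∫⁻ _r in Ioo (1 - t) 1, ENNReal.ofReal ((1 / 2) ^ (2 * N - 1)) *
          sphereMeasure N Q := by
          rw [setLIntegral_const, Real.volume_Ioo, sub_sub_cancel,
            ENNReal.ofReal_mul (by positivity)]
          ring
      _ ≤ ∫⁻ r in Ioo (1 - t) 1, ENNReal.ofReal (r ^ (2 * N - 1)) *
            ∫⁻ ξ : sphere (0 : CSpace N) 1, S.indicator 1 (r • (ξ : CSpace N))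
              ∂(sphereMeasure N) := by
          refine setLIntegral_mono' measurableSet_Ioo fun r hr => ?_
          have hr0 : 1 / 2 ≤ r := by linarith [hr.1]
          gcongr
          rw [← lintegral_indicator_one hQm]
          refine lintegral_mono fun ξ => le_of_eq ?_
          simp only [indicator, hmem r hr ξ, Pi.one_apply]
      _ ≤ _ := lintegral_mono_set fun r hr => by
          have := hr.1
          simp only [mem_Ioi]
          linarith
  have hc : 0 < (1 / 2 : ℝ) ^ (2 * N - 1) * t := by positivity
  rw [← ENNReal.mul_le_mul_iff_right (a := ENNReal.ofReal ((1 / 2) ^ (2 * N - 1) * t))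
    (by simpa using hc) ENNReal.ofReal_ne_top]
  refine (hlower.trans hupper).trans ?_
  rw [← ENNReal.ofReal_mul hc.le]
  refine ENNReal.ofReal_le_ofReal ?_
  have h5 : (1 / 2 : ℝ) ^ (2 * N - 1) * 2 ^ (2 * N - 1) = 1 := by
    rw [← mul_pow]; norm_num
  have h6 : 0 ≤ (1 / 2 : ℝ) ^ (2 * N - 1) * t * (2 ^ N * t ^ N) := by positivity
  calc t ^ (N + 1) * K = ((1 / 2 : ℝ) ^ (2 * N - 1) * 2 ^ (2 * N - 1)) * (t ^ (N + 1) * K) := by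
        rw [h5, one_mul]
    _ ≤ ((1 / 2 : ℝ) ^ (2 * N - 1) * 2 ^ (2 * N - 1)) * (t ^ (N + 1) * K) +
        (1 / 2 : ℝ) ^ (2 * N - 1) * t * (2 ^ N * t ^ N) := le_add_of_nonneg_right h6
    _ = _ := by ring

end Cap

/-! ### Negative powers by the layer-cake formula -/

section LayerCake

theorem lintegral_Ioc_rpow {s T : ℝ} (hs : -1 < s) (hT : 0 ≤ T) :
    ∫⁻ u in Ioc 0 T, ENNReal.ofReal (u ^ s) = ENNReal.ofReal (T ^ (s + 1) / (s + 1)) := by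
  have hi : IntervalIntegrable (fun u : ℝ => u ^ s) volume 0 T :=
    intervalIntegral.intervalIntegrable_rpow' hs
  rw [← ofReal_integral_eq_lintegral_ofReal hi.1
    ((ae_restrict_iff' measurableSet_Ioc).2 (Eventually.of_forall fun u hu =>
      Real.rpow_nonneg hu.1.le s)), ← intervalIntegral.integral_of_le hT,
    integral_rpow (Or.inl hs), Real.zero_rpow (by linarith), sub_zero]

/-- If the sublevel sets of `x ≥ δ` have measure at most `C * t ^ p`, then `x ^ (-q)` has integral
of order `δ ^ (p - q)` for `q > p`. -/
theorem lintegral_rpow_neg_le {α : Type*} [MeasurableSpace α] {μ : Measure α} {x : α → ℝ}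
    (hx : Measurable x) {δ C p q : ℝ} (hδ : 0 < δ) (hC : 0 ≤ C) (hq : 0 < q) (hpq : p < q)
    (hxδ : ∀ᵐ a ∂μ, δ ≤ x a) (hμ : ∀ t, 0 < t → μ {a | x a ≤ t} ≤ ENNReal.ofReal (C * t ^ p)) :
    ∫⁻ a, ENNReal.ofReal (x a ^ (-q)) ∂μ ≤ ENNReal.ofReal (q * C / (q - p) * δ ^ (p - q)) := by
  have h1 : ∫⁻ a, ENNReal.ofReal (x a ^ (-q)) ∂μ = ∫⁻ a, ENNReal.ofReal ((x a)⁻¹ ^ q) ∂μ := by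
    refine lintegral_congr_ae (hxδ.mono fun a ha => ?_)
    dsimp only
    rw [Real.rpow_neg (hδ.le.trans ha), Real.inv_rpow (hδ.le.trans ha)]
  have hnn : 0 ≤ᵐ[μ] fun a => (x a)⁻¹ := hxδ.mono fun a ha => inv_nonneg.2 (hδ.le.trans ha)
  have hδ' : 0 < δ⁻¹ := inv_pos.2 hδ
  rw [h1, lintegral_rpow_eq_lintegral_meas_le_mul μ hnn hx.inv.aemeasurable hq]
  -- The level sets of 1/x are null above 1/δ and have measure at most C t^(-p) below. Integrability
  -- of t^(q-p-1) at 0 is where p < q enters.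
  have h2 : ∫⁻ t in Ioi (0 : ℝ), μ {a | t ≤ (x a)⁻¹} * ENNReal.ofReal (t ^ (q - 1)) ≤
      ∫⁻ t in Ioi (0 : ℝ), (Ioc 0 δ⁻¹).indicator
        (fun t => ENNReal.ofReal C * ENNReal.ofReal (t ^ (q - p - 1))) t := by
    refine setLIntegral_mono' measurableSet_Ioi fun t ht => ?_
    have ht0 : (0 : ℝ) < t := ht
    by_cases htδ : t ≤ δ⁻¹
    · rw [indicator_of_mem (show t ∈ Ioc 0 δ⁻¹ from ⟨ht0, htδ⟩)]
      have h3 : μ {a | t ≤ (x a)⁻¹} ≤ μ {a | x a ≤ t⁻¹} := by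
        refine measure_mono_ae (hxδ.mono fun a ha hta => ?_)
        exact (le_inv_comm₀ ht0 (hδ.trans_le ha)).1 hta
      calc _ ≤ ENNReal.ofReal (C * t⁻¹ ^ p) * ENNReal.ofReal (t ^ (q - 1)) := by
            gcongr
            exact h3.trans (hμ _ (inv_pos.2 ht0))
        _ = _ := by
            rw [← ENNReal.ofReal_mul (by positivity), ← ENNReal.ofReal_mul hC, mul_assoc,
              Real.inv_rpow ht0.le, ← Real.rpow_neg ht0.le, ← Real.rpow_add ht0]
            ring_nf
    · have h3 : μ {a | t ≤ (x a)⁻¹} = 0 := by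
        refine measure_mono_null_ae (t := ∅) (hxδ.mono fun a ha hta => ?_) measure_empty
        exact htδ (hta.trans (inv_anti₀ hδ ha))
      rw [h3, zero_mul]
      exact bot_le
  refine (mul_le_mul_right h2 _).trans (le_of_eq ?_)
  rw [setLIntegral_indicator measurableSet_Ioc, inter_eq_self_of_subset_left
    (Ioc_subset_Ioi_self : Ioc 0 δ⁻¹ ⊆ Ioi 0), lintegral_const_mul' _ _ ENNReal.ofReal_ne_top,
    lintegral_Ioc_rpow (by linarith) hδ'.le, ← ENNReal.ofReal_mul hC,
    ← ENNReal.ofReal_mul hq.le, Real.inv_rpow hδ.le, ← Real.rpow_neg hδ.le]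
  ring_nf

end LayerCake

/-! ### Norm estimates for the test functions -/

section Kernel

variable {N : ℕ}

theorem HolOnBall.measurable {f : CSpace N → ℂ} (hf : HolOnBall f) : Measurable f := by
  classical
  have h : f = (ball (0 : CSpace N) 1).piecewise f 0 := by
    funext z
    by_cases hz : z ∈ ball (0 : CSpace N) 1
    · simp [hz]
    · simp [hz, hf.2 z hz]
  rw [h]
  exact hf.1.continuousOn.measurable_piecewise continuousOn_const measurableSet_ball

/-- The function `z ↦ (1 - ⟨z, a⟩)⁻ᵐ` on the ball, extended by zero. -/
noncomputable def kernelFun (m : ℕ) (a : CSpace N) : CSpace N → ℂ :=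
  (ball 0 1).indicator fun z => (1 - inner ℂ a z)⁻¹ ^ m

theorem kernelFun_apply (m : ℕ) (a : CSpace N) {z : CSpace N} (hz : ‖z‖ < 1) :
    kernelFun m a z = (1 - inner ℂ a z)⁻¹ ^ m :=
  indicator_of_mem (by simpa using hz) _

theorem holOnBall_kernelFun (m : ℕ) {a : CSpace N} (ha : ‖a‖ < 1) :
    HolOnBall (kernelFun m a) := by
  refine ⟨DifferentiableOn.congr (f := fun z => (1 - inner ℂ a z)⁻¹ ^ m) ?_ fun z hz =>
    indicator_of_mem hz _, fun z hz => indicator_of_notMem hz _⟩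
  have hi : Differentiable ℂ fun z : CSpace N => inner ℂ a z := (innerSL ℂ a).differentiable
  exact ((hi.const_sub 1).differentiableOn.inv fun z hz =>
    one_sub_inner_ne_zero ha.le (by simpa using hz)).pow m

theorem one_sub_norm_le_norm_one_sub_inner {a z : CSpace N} (hz : ‖z‖ ≤ 1) :
    1 - ‖a‖ ≤ ‖1 - inner ℂ a z‖ := by
  have h1 := norm_inner_le_norm (𝕜 := ℂ) a z
  have h2 := norm_sub_norm_le (1 : ℂ) (inner ℂ a z)
  rw [norm_one] at h2
  nlinarith [norm_nonneg a]

/-- The bound blows up as a tends to the sphere, but for fixed a it makes the image of the kernel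
under C_φ - C_ψ a bounded function; the compactness argument needs no more. -/
theorem norm_kernelFun_le (m : ℕ) {a : CSpace N} (ha : ‖a‖ < 1) (z : CSpace N) :
    ‖kernelFun m a z‖ ≤ (1 - ‖a‖)⁻¹ ^ m := by
  have h0 : 0 < 1 - ‖a‖ := sub_pos.2 ha
  by_cases hz : ‖z‖ < 1
  · rw [kernelFun_apply m a hz, norm_pow, norm_inv]
    gcongr
    exact one_sub_norm_le_norm_one_sub_inner hz.le
  · rw [kernelFun, indicator_of_notMem (by simpa using hz), norm_zero]
    positivity

theorem exists_norm_eq_smul [NeZero N] (a : CSpace N) :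
    ∃ e : CSpace N, ‖e‖ = 1 ∧ a = ‖a‖ • e := by
  by_cases ha : a = 0
  · obtain ⟨e, he⟩ := exists_norm_eq (CSpace N) zero_le_one
    exact ⟨e, he, by simp [ha]⟩
  · have : ‖a‖ ≠ 0 := norm_ne_zero_iff.2 ha
    exact ⟨(‖a‖⁻¹ : ℝ) • a, by simp [norm_smul, this], by simp [smul_smul, this]⟩

/-- With a = |a|e and κ = r|a|, the integrand is |1 - κ⟨ξ, e⟩|^(-2m). The base is at least 1 - κ and
its sublevel sets are caps of measure O(t^N), so the layer-cake bound applies with p = N, q = 2m. -/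
theorem exists_sphere_kernelFun_le (N : ℕ) [NeZero N] {m : ℕ} (hm : N < 2 * m) :
    ∃ C : ℝ, 0 < C ∧ ∀ a : CSpace N, ‖a‖ < 1 → ∀ r ∈ Ioo (0 : ℝ) 1,
      ∫⁻ ξ : sphere (0 : CSpace N) 1, ‖kernelFun m a (r • (ξ : CSpace N))‖ₑ ^ 2
        ∂(sphereMeasure N) ≤ ENNReal.ofReal (C * (1 - r * ‖a‖) ^ ((N : ℝ) - 2 * m)) := by
  obtain ⟨C, hC, hcap⟩ := exists_sphereMeasure_cap_le N
  have hm' : (N : ℝ) < 2 * m := by exact_mod_cast hm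
  have hq : (0 : ℝ) < 2 * m := lt_of_le_of_lt N.cast_nonneg hm'
  refine ⟨2 * m * C / (2 * m - N), by have := sub_pos.2 hm'; positivity, fun a ha r hr => ?_⟩
  obtain ⟨e, he, hae⟩ := exists_norm_eq_smul a
  have hκ : r * ‖a‖ < 1 := by nlinarith [norm_nonneg a, hr.1, hr.2]
  have hκ0 : 0 ≤ r * ‖a‖ := mul_nonneg hr.1.le (norm_nonneg a)
  have hin : ∀ ξ : CSpace N, inner ℂ a (r • ξ) = ((r * ‖a‖ : ℝ) : ℂ) * inner ℂ e ξ := by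
    intro ξ
    conv_lhs => rw [hae]
    rw [← Complex.coe_smul, ← Complex.coe_smul, inner_smul_left, inner_smul_right,
      Complex.conj_ofReal]
    push_cast
    ring
  have key := lintegral_rpow_neg_le (μ := sphereMeasure N)
    (x := fun ξ : sphere (0 : CSpace N) 1 =>
      ‖1 - ((r * ‖a‖ : ℝ) : ℂ) * inner ℂ e (ξ : CSpace N)‖)
    ((measurable_norm_one_sub_inner _ e).comp measurable_subtype_coe) (δ := 1 - r * ‖a‖)
    (C := C) (p := N) (q := 2 * m) (sub_pos.2 hκ) hC.le hq hm'
    (Eventually.of_forall fun ξ => ?_) (fun t ht => ?_)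
  · refine le_trans (le_of_eq (lintegral_congr fun ξ => ?_)) key
    have hn : ‖r • (ξ : CSpace N)‖ < 1 := by simp [norm_smul, abs_of_pos hr.1, hr.2]
    rw [kernelFun_apply m a hn, hin, ← ofReal_norm, ← ENNReal.ofReal_pow (norm_nonneg _),
      Real.rpow_neg (norm_nonneg _), norm_pow, norm_inv, ← pow_mul, inv_pow, mul_comm m 2]
    norm_cast
  · have := one_sub_norm_le_norm_one_sub_inner (a := a) (z := (ξ : CSpace N)) (by simp)
    have h1 := norm_inner_le_norm (𝕜 := ℂ) e (ξ : CSpace N)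
    have h2 := norm_sub_norm_le (1 : ℂ) (((r * ‖a‖ : ℝ) : ℂ) * inner ℂ e (ξ : CSpace N))
    rw [norm_one, norm_mul, Complex.norm_real, Real.norm_eq_abs, abs_of_nonneg hκ0] at h2
    simp only [he, norm_eq_of_mem_sphere, mul_one] at h1
    nlinarith
  · refine (hcap e he _ hκ0 hκ.le t ht).trans (le_of_eq ?_)
    rw [Real.rpow_natCast]

theorem exists_hardySq_kernelFun_le (N : ℕ) [NeZero N] {m : ℕ} (hm : N < 2 * m) :
    ∃ C : ℝ, 0 < C ∧ ∀ a : CSpace N, ‖a‖ < 1 →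
      hardySq (kernelFun m a) ≤ ENNReal.ofReal (C * (1 - ‖a‖) ^ ((N : ℝ) - 2 * m)) := by
  obtain ⟨C, hC, h⟩ := exists_sphere_kernelFun_le N hm
  have hm' : (N : ℝ) < 2 * m := by exact_mod_cast hm
  refine ⟨C, hC, fun a ha => iSup₂_le fun r hr => (h a ha r hr).trans ?_⟩
  have h1 : 1 - ‖a‖ ≤ 1 - r * ‖a‖ := by nlinarith [norm_nonneg a, hr.2]
  exact ENNReal.ofReal_le_ofReal (mul_le_mul_of_nonneg_left
    (Real.rpow_le_rpow_of_nonpos (sub_pos.2 ha) h1 (by linarith)) hC.le)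

/-- The constant of the Bergman weight. -/
noncomputable def bergmanConst (N : ℕ) (s : ℝ) : ℝ :=
  Real.Gamma (N + s + 1) / (Real.Gamma (N + 1) * Real.Gamma (s + 1))

theorem bergmanConst_pos (N : ℕ) {s : ℝ} (hs : -1 < s) : 0 < bergmanConst N s := by
  have hN : (0 : ℝ) ≤ N := N.cast_nonneg
  have := Real.Gamma_pos_of_pos (show (0 : ℝ) < N + s + 1 by linarith)
  have := Real.Gamma_pos_of_pos (show (0 : ℝ) < N + 1 by linarith)
  have := Real.Gamma_pos_of_pos (show (0 : ℝ) < s + 1 by linarith)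
  unfold bergmanConst
  positivity

/-- The Bergman norm as an integral of spherical means. -/
theorem bergmanSq_eq_polar [NeZero N] (s : ℝ) {f : CSpace N → ℂ} (hf : HolOnBall f) :
    bergmanSq s f = (2 * N : ℕ) * ∫⁻ r in Ioo (0 : ℝ) 1, ENNReal.ofReal (r ^ (2 * N - 1)) *
      (ENNReal.ofReal (bergmanConst N s * (1 - r ^ 2) ^ s) *
        ∫⁻ ξ : sphere (0 : CSpace N) 1, ‖f (r • (ξ : CSpace N))‖ₑ ^ 2 ∂(sphereMeasure N)) := by
  have hm : Measurable fun z : CSpace N => ‖f z‖ₑ ^ 2 * ENNReal.ofReal (bergmanWeight N s z) :=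
    (hf.measurable.enorm.pow_const 2).mul (measurable_bergmanWeight N s).ennreal_ofReal
  have h0 : bergmanSq s f =
      ∫⁻ z, ‖f z‖ₑ ^ 2 * ENNReal.ofReal (bergmanWeight N s z) ∂(ballMeasure N) := by
    rw [bergmanSq, ← lintegral_indicator measurableSet_ball]
    refine lintegral_congr fun z => ?_
    by_cases hz : z ∈ ball (0 : CSpace N) 1
    · rw [indicator_of_mem hz]
    · rw [indicator_of_notMem hz, hf.2 z hz]
      simp
  rw [h0, lintegral_polar hm]
  congr 1
  have hnorm : ∀ r ∈ Ioi (0 : ℝ), ∀ ξ : sphere (0 : CSpace N) 1, ‖r • (ξ : CSpace N)‖ = r :=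
    fun r hr ξ => by simp [norm_smul, abs_of_pos (show (0 : ℝ) < r from hr)]
  rw [← Ioi_inter_Iio, inter_comm, ← setLIntegral_indicator measurableSet_Iio]
  refine setLIntegral_congr_fun measurableSet_Ioi fun r hr => ?_
  by_cases hr1 : r < 1
  · rw [indicator_of_mem (show r ∈ Iio 1 from hr1)]
    congr 1
    rw [← lintegral_const_mul' _ _ ENNReal.ofReal_ne_top]
    refine lintegral_congr fun ξ => ?_
    rw [bergmanWeight, hnorm r hr ξ, mul_comm]
    rfl
  · rw [indicator_of_notMem (show r ∉ Iio 1 from hr1)]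
    have h1 : ∀ ξ : sphere (0 : CSpace N) 1, f (r • (ξ : CSpace N)) = 0 := fun ξ =>
      hf.2 _ (by simpa [hnorm r hr ξ] using hr1)
    simp [h1]

theorem one_sub_sq_rpow_le {r s : ℝ} (hr : r ∈ Ioo (0 : ℝ) 1) :
    (1 - r ^ 2) ^ s ≤ 2 ^ |s| * (1 - r) ^ s := by
  have h1 : 1 - r ^ 2 = (1 + r) * (1 - r) := by ring
  have h2 : (1 + r) ^ s ≤ 2 ^ |s| :=
    (Real.rpow_le_rpow_of_exponent_le (by linarith [hr.1]) (le_abs_self s)).trans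
      (Real.rpow_le_rpow (by linarith [hr.1]) (by linarith [hr.2]) (abs_nonneg s))
  rw [h1, Real.mul_rpow (by linarith [hr.1]) (by linarith [hr.2])]
  have := Real.rpow_nonneg (sub_nonneg.2 hr.2.le) s
  gcongr

theorem lintegral_one_sub_rpow_sublevel_le {s t : ℝ} (hs : -1 < s) (ht : 0 < t) :
    ∫⁻ r in Ioo (0 : ℝ) 1 ∩ {r | 1 - r ≤ t}, ENNReal.ofReal ((1 - r) ^ s) ≤
      ENNReal.ofReal (t ^ (s + 1) / (s + 1)) := by
  have h1 : ∫⁻ r in Ioo (0 : ℝ) 1 ∩ {r | 1 - r ≤ t}, ENNReal.ofReal ((1 - r) ^ s) ≤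
      ∫⁻ r, (Ioc 0 t).indicator (fun u => ENNReal.ofReal (u ^ s)) (1 - r) := by
    rw [← lintegral_indicator (measurableSet_Ioo.inter
      (measurableSet_le (by fun_prop) measurable_const))]
    refine lintegral_mono fun r => ?_
    by_cases hr : r ∈ Ioo (0 : ℝ) 1 ∩ {r | 1 - r ≤ t}
    · rw [indicator_of_mem hr, indicator_of_mem (show 1 - r ∈ Ioc 0 t from
        ⟨sub_pos.2 hr.1.2, hr.2⟩)]
    · rw [indicator_of_notMem hr]
      exact bot_le
  rw [lintegral_sub_left_eq_self (fun u => (Ioc 0 t).indicator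
    (fun u => ENNReal.ofReal (u ^ s)) u) 1, lintegral_indicator measurableSet_Ioc,
    lintegral_Ioc_rpow hs ht.le] at h1
  exact h1

/-- After the spherical estimate, the layer-cake bound is used again for the radial measure (1 -
r)^s dr, with p = s + 1 and q = 2m - N. Sublevel sets of 1 - r|a| lie in those of 1 - r, so the
constant does not depend on a. -/
theorem exists_bergmanSq_kernelFun_le (N : ℕ) [NeZero N] {s : ℝ} (hs : -1 < s) {m : ℕ}
    (hm : (N : ℝ) + 1 + s < 2 * m) :
    ∃ C : ℝ, 0 < C ∧ ∀ a : CSpace N, ‖a‖ < 1 → bergmanSq s (kernelFun m a) ≤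
      ENNReal.ofReal (C * (1 - ‖a‖) ^ ((N : ℝ) + 1 + s - 2 * m)) := by
  have hm' : N < 2 * m := by
    have : (N : ℝ) < 2 * m := by linarith
    exact_mod_cast this
  obtain ⟨C, hC, h⟩ := exists_sphere_kernelFun_le N hm'
  have hs1 : 0 < s + 1 := by linarith
  have hc := bergmanConst_pos N hs
  have hN : (0 : ℝ) < N := by exact_mod_cast Nat.pos_of_ne_zero (NeZero.ne N)
  have hq : 0 < 2 * m - (N : ℝ) := by linarith
  set K : ℝ := 2 * N * (bergmanConst N s * 2 ^ |s| * C)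
  have hK : 0 < K := by positivity
  set K' : ℝ := (2 * m - (N : ℝ)) * (1 / (s + 1)) / ((2 * m - (N : ℝ)) - (s + 1))
  have hK' : 0 < K' := by
    have : 0 < (2 * m - (N : ℝ)) - (s + 1) := by linarith
    positivity
  refine ⟨K * K', by positivity, fun a ha => ?_⟩
  have hle : ∀ r ∈ Ioo (0 : ℝ) 1, 1 - ‖a‖ ≤ 1 - r * ‖a‖ := fun r hr => by
    nlinarith [norm_nonneg a, hr.2]
  set μ : Measure ℝ := (volume.restrict (Ioo (0 : ℝ) 1)).withDensity
    fun r => ENNReal.ofReal ((1 - r) ^ s) with hμ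
  have hw : Measurable fun r : ℝ => ENNReal.ofReal ((1 - r) ^ s) := by fun_prop
  have hae : ∀ᵐ r ∂μ, r ∈ Ioo (0 : ℝ) 1 :=
    (withDensity_absolutelyContinuous _ _).ae_le (ae_restrict_mem measurableSet_Ioo)
  have key := lintegral_rpow_neg_le (μ := μ) (x := fun r : ℝ => 1 - r * ‖a‖) (by fun_prop)
    (δ := 1 - ‖a‖) (C := 1 / (s + 1)) (p := s + 1) (q := 2 * m - N) (sub_pos.2 ha)
    (by positivity) hq (by linarith) (hae.mono hle) (fun t ht => by
      have hms : MeasurableSet {r : ℝ | 1 - r * ‖a‖ ≤ t} :=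
        measurableSet_le (by fun_prop) measurable_const
      rw [hμ, withDensity_apply _ hms, Measure.restrict_restrict hms]
      refine le_trans (lintegral_mono_set (t := Ioo (0 : ℝ) 1 ∩ {r | 1 - r ≤ t}) ?_)
        ((lintegral_one_sub_rpow_sublevel_le hs ht).trans (le_of_eq (by ring_nf)))
      intro r hr
      have h1 : 1 - r * ‖a‖ ≤ t := hr.1
      refine ⟨hr.2, show 1 - r ≤ t from ?_⟩
      nlinarith [hr.2.1, hr.2.2])
  have hkey : ∫⁻ r in Ioo (0 : ℝ) 1, ENNReal.ofReal ((1 - r) ^ s) *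
      ENNReal.ofReal ((1 - r * ‖a‖) ^ ((N : ℝ) - 2 * m)) ≤
      ENNReal.ofReal (K' * (1 - ‖a‖) ^ ((N : ℝ) + 1 + s - 2 * m)) := by
    rw [hμ, lintegral_withDensity_eq_lintegral_mul₀ hw.aemeasurable (by fun_prop)] at key
    simp only [Pi.mul_apply, neg_sub] at key
    refine key.trans (le_of_eq ?_)
    congr 3
    ring
  rw [bergmanSq_eq_polar s (holOnBall_kernelFun m ha)]
  calc _ ≤ ((2 * N : ℕ) : ℝ≥0∞) * ∫⁻ r in Ioo (0 : ℝ) 1,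
        ENNReal.ofReal (bergmanConst N s * 2 ^ |s| * C) * (ENNReal.ofReal ((1 - r) ^ s) *
          ENNReal.ofReal ((1 - r * ‖a‖) ^ ((N : ℝ) - 2 * m))) := by
        refine mul_le_mul_right ?_ _
        refine setLIntegral_mono' measurableSet_Ioo fun r hr => ?_
        have hp : 0 ≤ 1 - r * ‖a‖ := (sub_pos.2 ha).le.trans (hle r hr)
        have h1 : ENNReal.ofReal (r ^ (2 * N - 1)) ≤ 1 :=
          ENNReal.ofReal_le_one.2 (pow_le_one₀ hr.1.le hr.2.le)
        have h2 := one_sub_sq_rpow_le (s := s) hr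
        have h3 := Real.rpow_nonneg (sub_nonneg.2 hr.2.le) s
        calc _ ≤ 1 * (ENNReal.ofReal (bergmanConst N s * (2 ^ |s| * (1 - r) ^ s)) *
              ENNReal.ofReal (C * (1 - r * ‖a‖) ^ ((N : ℝ) - 2 * m))) := by
              gcongr
              exact h a ha r hr
          _ = _ := by
              rw [one_mul, ← ENNReal.ofReal_mul (by positivity), ← ENNReal.ofReal_mul h3,
                ← ENNReal.ofReal_mul (by positivity)]
              ring_nf
    _ ≤ ENNReal.ofReal (2 * N) * (ENNReal.ofReal (bergmanConst N s * 2 ^ |s| * C) *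
          ENNReal.ofReal (K' * (1 - ‖a‖) ^ ((N : ℝ) + 1 + s - 2 * m))) := by
        rw [lintegral_const_mul' _ _ ENNReal.ofReal_ne_top]
        gcongr ?_ * (_ * ?_)
        rw [← ENNReal.ofReal_natCast]
        push_cast
        exact le_rfl
    _ = _ := by
        rw [← ENNReal.ofReal_mul (by positivity), ← ENNReal.ofReal_mul (by positivity)]
        simp only [K]
        ring_nf

end Kernel

/-! ### Point evaluation bounds -/

section PointEvaluation

variable {N : ℕ}

theorem measurePreserving_unit_smul {c : ℂ} (hc : ‖c‖ = 1) :
    MeasurePreserving (fun z : CSpace N => c • z) volume volume := by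
  let L : CSpace N →ₗᵢ[ℝ] CSpace N :=
    { toLinearMap := (c • (LinearMap.id : CSpace N →ₗ[ℂ] CSpace N)).restrictScalars ℝ
      norm_map' := fun z => by simp [norm_smul, hc] }
  exact (L.toLinearIsometryEquiv rfl).measurePreserving

/-- This is the mean value property of the holomorphic function h², with the modulus taken inside
the integral. -/
theorem enorm_sq_mul_le_lintegral_circle {h : ℂ → ℂ} (hd : DiffContOnCl ℂ h (ball 0 1)) :
    ‖h 0‖ₑ ^ 2 * ENNReal.ofReal (2 * Real.pi) ≤
      ∫⁻ θ in Ioc 0 (2 * Real.pi), ‖h (circleMap 0 1 θ)‖ₑ ^ 2 := by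
  have hpi : 0 < 2 * Real.pi := Real.two_pi_pos
  have hd2 : DiffContOnCl ℂ (fun z => h z * h z) (ball 0 |1|) := by
    rw [abs_one]
    exact ⟨hd.1.mul hd.1, hd.2.mul hd.2⟩
  have hmean := hd2.circleAverage
  rw [Real.circleAverage_def] at hmean
  have h1 : ∫ θ in 0..2 * Real.pi, h (circleMap 0 1 θ) * h (circleMap 0 1 θ) =
      (2 * Real.pi) • (h 0 * h 0) := by
    rw [← hmean, smul_smul, mul_inv_cancel₀ hpi.ne', one_smul]
  have h2 : ‖(2 * Real.pi) • (h 0 * h 0)‖ₑ = ‖h 0‖ₑ ^ 2 * ENNReal.ofReal (2 * Real.pi) := by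
    rw [enorm_smul, Real.enorm_eq_ofReal hpi.le, enorm_mul, sq, mul_comm]
  rw [← h2, ← h1, intervalIntegral.integral_of_le hpi.le]
  refine (enorm_integral_le_lintegral_enorm _).trans (le_of_eq ?_)
  simp only [enorm_mul, sq]

/-- The sub-mean value property of `|g|²` on the unit ball. -/
theorem enorm_sq_mul_volume_ball_le {g : CSpace N → ℂ} (hg : DifferentiableOn ℂ g (ball 0 1)) :
    ‖g 0‖ₑ ^ 2 * (volume : Measure (CSpace N)) (ball 0 1) ≤ ∫⁻ u in ball 0 1, ‖g u‖ₑ ^ 2 := by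
  classical
  have hpi : 0 < 2 * Real.pi := Real.two_pi_pos
  set G : CSpace N → ℝ≥0∞ := (ball (0 : CSpace N) 1).indicator fun u => ‖g u‖ₑ ^ 2 with hG
  have hGm : Measurable G := by
    have h1 : G = (ball (0 : CSpace N) 1).indicator
        fun u => ‖(ball (0 : CSpace N) 1).indicator g u‖ₑ ^ 2 := by
      funext u
      by_cases hu : u ∈ ball (0 : CSpace N) 1 <;> simp [hG, hu]
    have h2 : Measurable ((ball (0 : CSpace N) 1).indicator g) := by
      rw [← piecewise_eq_indicator]
      exact hg.continuousOn.measurable_piecewise continuousOn_const measurableSet_ball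
    rw [h1]
    exact (h2.enorm.pow_const 2).indicator measurableSet_ball
  have hcirc : ∀ θ : ℝ, ‖circleMap 0 1 θ‖ = 1 := fun θ => by simp
  have hcm : Measurable fun p : CSpace N × ℝ => G (circleMap 0 1 p.2 • p.1) := by
    refine hGm.comp (Continuous.measurable ?_)
    fun_prop
  -- The circle inequality is applied to the slice l ↦ g(lu). Integrating over u, exchanging the
  -- integrals and using invariance under unimodular scalars makes the θ-integral a factor 2π, which
  -- cancels.
  have hpt : ∀ u ∈ ball (0 : CSpace N) 1, ‖g 0‖ₑ ^ 2 * ENNReal.ofReal (2 * Real.pi) ≤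
      ∫⁻ θ in Ioc 0 (2 * Real.pi), G (circleMap 0 1 θ • u) := by
    intro u hu
    have hu1 : ‖u‖ < 1 := by simpa using hu
    have hd : DiffContOnCl ℂ (fun l : ℂ => g (l • u)) (ball 0 1) := by
      refine DifferentiableOn.diffContOnCl ?_
      refine hg.comp (by fun_prop) fun l hl => ?_
      have hl1 : ‖l‖ ≤ 1 := by simpa using closure_ball_subset_closedBall hl
      simp only [mem_ball, dist_zero_right, norm_smul]
      nlinarith [norm_nonneg u, norm_nonneg l]
    have h := enorm_sq_mul_le_lintegral_circle hd
    rw [zero_smul] at h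
    refine h.trans (le_of_eq (lintegral_congr fun θ => ?_))
    rw [hG, indicator_of_mem]
    simpa [norm_smul, hcirc] using hu1
  have hint : ∀ θ : ℝ, ∫⁻ u, G (circleMap 0 1 θ • u) = ∫⁻ u in ball 0 1, ‖g u‖ₑ ^ 2 := fun θ => by
    rw [(measurePreserving_unit_smul (hcirc θ)).lintegral_comp hGm,
      lintegral_indicator measurableSet_ball]
  have hsum : ‖g 0‖ₑ ^ 2 * ENNReal.ofReal (2 * Real.pi) *
      (volume : Measure (CSpace N)) (ball 0 1) ≤
      (∫⁻ u in ball (0 : CSpace N) 1, ‖g u‖ₑ ^ 2) * ENNReal.ofReal (2 * Real.pi) := by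
    calc _ = ∫⁻ _u in ball (0 : CSpace N) 1, ‖g 0‖ₑ ^ 2 * ENNReal.ofReal (2 * Real.pi) := by
          rw [setLIntegral_const]
      _ ≤ ∫⁻ u in ball (0 : CSpace N) 1, ∫⁻ θ in Ioc 0 (2 * Real.pi),
            G (circleMap 0 1 θ • u) := setLIntegral_mono' measurableSet_ball hpt
      _ ≤ ∫⁻ u : CSpace N, ∫⁻ θ in Ioc 0 (2 * Real.pi), G (circleMap 0 1 θ • u) :=
          setLIntegral_le_lintegral _ _
      _ = ∫⁻ θ in Ioc 0 (2 * Real.pi), ∫⁻ u : CSpace N, G (circleMap 0 1 θ • u) :=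
          lintegral_lintegral_swap hcm.aemeasurable
      _ = _ := by
          simp only [hint]
          rw [setLIntegral_const, Real.volume_Ioc, sub_zero]
  have h2pi : ENNReal.ofReal (2 * Real.pi) ≠ 0 := by simpa using Real.pi_pos
  rw [mul_right_comm] at hsum
  exact (ENNReal.mul_le_mul_iff_left h2pi ENNReal.ofReal_ne_top).1 hsum

/-- Half the anisotropic ball around `r • e` lies in a spherical shell. -/
theorem shell_of_aniso {e : CSpace N} (he : ‖e‖ = 1) {r : ℝ} (hr0 : 0 ≤ r) (hr1 : r < 1)
    {u : CSpace N} (hu : ‖u‖ < 1) :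
    1 - ‖r • e + (1 / 2 : ℝ) • anisoMap e √(1 - r) u‖ ∈
      Icc (3 / 8 * (1 - r)) (3 / 2 * (1 - r)) := by
  have hδ : 0 < 1 - r := sub_pos.2 hr1
  have hτ : √(1 - r) ^ 2 = 1 - r := Real.sq_sqrt hδ.le
  have hx : ‖inner ℂ e u‖ ≤ 1 := by
    have := norm_inner_le_norm (𝕜 := ℂ) e u
    rw [he] at this
    linarith
  set v := (1 / 2 : ℝ) • anisoMap e √(1 - r) u with hv
  have hin : inner ℂ e v = (((1 - r) / 2 : ℝ) : ℂ) * inner ℂ e u := by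
    rw [hv, ← Complex.coe_smul, inner_smul_right, inner_anisoMap he, ← Complex.ofReal_pow, hτ]
    push_cast
    ring
  have hnv : ‖v‖ ^ 2 ≤ (1 - r) / 4 := by
    rw [hv, norm_smul, mul_pow, norm_sq_anisoMap he, hτ]
    have h1 : (1 - r - 1) * ‖inner ℂ e u‖ ^ 2 ≤ 0 :=
      mul_nonpos_of_nonpos_of_nonneg (by linarith) (by positivity)
    have h2 : ‖u‖ ^ 2 ≤ 1 := by nlinarith [norm_nonneg u]
    norm_num
    nlinarith
  have hre : |(inner ℂ e v : ℂ).re| ≤ (1 - r) / 2 := by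
    refine (Complex.abs_re_le_norm _).trans ?_
    rw [hin, norm_mul, Complex.norm_real, Real.norm_eq_abs, abs_of_nonneg (by linarith)]
    nlinarith
  -- The sum r² + r(1 - r) + (1 - r)/4 of the three bounds equals 1 - (3/4)(1 - r).
  have hsq : ‖r • e + v‖ ^ 2 ≤ 1 - 3 / 4 * (1 - r) := by
    rw [norm_add_sq (𝕜 := ℂ), ← Complex.coe_smul, inner_smul_left, norm_smul, he,
      Complex.norm_real, Real.norm_eq_abs, abs_of_nonneg hr0, Complex.conj_ofReal]
    simp only [RCLike.re_to_complex, Complex.re_ofReal_mul]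
    nlinarith [le_abs_self (inner ℂ e v : ℂ).re]
  have hlow : 1 - 3 / 2 * (1 - r) ≤ ‖r • e + v‖ := by
    have h1 := norm_inner_le_norm (𝕜 := ℂ) e (r • e + v)
    rw [he, one_mul] at h1
    have h2 := Complex.re_le_norm (inner ℂ e (r • e + v))
    rw [inner_add_right, ← Complex.coe_smul, inner_smul_right, inner_self_eq_norm_sq_to_K, he]
      at h2
    simp at h2
    have h3 := neg_le_of_abs_le hre
    rw [inner_add_right, ← Complex.coe_smul, inner_smul_right, inner_self_eq_norm_sq_to_K, he]
      at h1
    simp at h1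
    linarith
  refine ⟨?_, by linarith⟩
  -- From 1 - |x|² ≤ 2(1 - |x|), half of 3/4 gives the constant 3/8.
  nlinarith [norm_nonneg (r • e + v), sq_nonneg (1 - ‖r • e + v‖)]

/-- Point evaluation is controlled by the mean of `|f|²` over a spherical shell. -/
theorem enorm_sq_le_shell [NeZero N] {f : CSpace N → ℂ} (hf : HolOnBall f) {w : CSpace N}
    (hw : ‖w‖ < 1) :
    ‖f w‖ₑ ^ 2 ≤ ENNReal.ofReal (4 ^ N * ((1 - ‖w‖) ^ (N + 1))⁻¹) *
      ∫⁻ z in {z | 1 - ‖z‖ ∈ Icc (3 / 8 * (1 - ‖w‖)) (3 / 2 * (1 - ‖w‖))},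
        ‖f z‖ₑ ^ 2 ∂(ballMeasure N) := by
  obtain ⟨e, he, hwe⟩ := exists_norm_eq_smul w
  set δ := 1 - ‖w‖ with hδdef
  have hδ : 0 < δ := sub_pos.2 hw
  set R : Set (CSpace N) := {z | 1 - ‖z‖ ∈ Icc (3 / 8 * δ) (3 / 2 * δ)} with hR
  have hRm : MeasurableSet R := (measurable_norm.const_sub 1) measurableSet_Icc
  set B : CSpace N →ₗ[ℝ] CSpace N := (1 / 2 : ℝ) • (anisoMap e √δ).restrictScalars ℝ with hB
  have hBu : ∀ u, B u = (1 / 2 : ℝ) • anisoMap e √δ u := fun u => rfl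
  -- The factor 1/2 acts on real dimension 2N, which gives 4^(-N). The inverse of this determinant
  -- is the constant in the estimate.
  have hdet : LinearMap.det B = (4 ^ N)⁻¹ * δ ^ (N + 1) := by
    rw [hB, LinearMap.det_smul, det_anisoMap he, finrank_real_cspace, ← pow_mul,
      mul_comm (N + 1) 2, pow_mul (√δ), Real.sq_sqrt hδ.le, pow_mul (1 / 2 : ℝ), ← inv_pow]
    norm_num
  have hdet0 : LinearMap.det B ≠ 0 := by rw [hdet]; positivity
  have hmem : ∀ u ∈ ball (0 : CSpace N) 1, w + B u ∈ R := fun u hu => by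
    have := shell_of_aniso he (norm_nonneg w) hw (u := u) (by simpa using hu)
    rw [← hwe] at this
    exact this
  have hsub : ∀ z ∈ R, z ∈ ball (0 : CSpace N) 1 := fun z hz => by
    have h1 : 3 / 8 * δ ≤ 1 - ‖z‖ := hz.1
    simp only [mem_ball, dist_zero_right]
    linarith
  have hBd : Differentiable ℂ fun u : CSpace N => w + B u := by
    have h1 : (fun u => w + B u) = fun u => w + (((1 / 2 : ℝ) : ℂ) •
        (LinearMap.toContinuousLinearMap (anisoMap e √δ))) u := by
      funext u
      rw [hBu, ← Complex.coe_smul]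
      rfl
    rw [h1]
    exact (ContinuousLinearMap.differentiable _).const_add w
  have hmean := enorm_sq_mul_volume_ball_le (g := fun u => f (w + B u))
    (hf.1.comp hBd.differentiableOn fun u hu => hsub _ (hmem u hu))
  rw [map_zero, add_zero] at hmean
  set G : CSpace N → ℝ≥0∞ := R.indicator fun z => ‖f z‖ₑ ^ 2 with hG
  have hGm : Measurable G := (hf.measurable.enorm.pow_const 2).indicator hRm
  have hchange : ∫⁻ u in ball (0 : CSpace N) 1, ‖f (w + B u)‖ₑ ^ 2 ≤
      ENNReal.ofReal (4 ^ N * (δ ^ (N + 1))⁻¹) * ∫⁻ z in R, ‖f z‖ₑ ^ 2 := by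
    calc _ = ∫⁻ u in ball (0 : CSpace N) 1, G (w + B u) :=
          setLIntegral_congr_fun measurableSet_ball fun u hu => by
            rw [hG, indicator_of_mem (hmem u hu)]
      _ ≤ ∫⁻ u, G (w + B u) := setLIntegral_le_lintegral _ _
      _ = ∫⁻ v, G (w + v) ∂(Measure.map B volume) :=
          (lintegral_map (hGm.comp (measurable_const_add w))
            (LinearMap.continuous_of_finiteDimensional B).measurable).symm
      _ = ENNReal.ofReal |(LinearMap.det B)⁻¹| * ∫⁻ v, G (w + v) := by
          rw [Measure.map_linearMap_addHaar_eq_smul_addHaar volume hdet0, lintegral_smul_measure,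
            smul_eq_mul]
      _ = _ := by
          rw [lintegral_add_left_eq_self, lintegral_indicator hRm, hdet, abs_of_nonneg
            (by positivity), mul_inv, inv_inv]
  have hV0 := volume_unitBall_ne_zero N
  have hVt := volume_unitBall_ne_top N
  have hres : ∫⁻ z in R, ‖f z‖ₑ ^ 2 ∂(ballMeasure N) =
      ((volume : Measure (CSpace N)) (ball 0 1))⁻¹ * ∫⁻ z in R, ‖f z‖ₑ ^ 2 := by
    rw [ballMeasure, Measure.restrict_smul, lintegral_smul_measure, smul_eq_mul]
  rw [hres, mul_left_comm, mul_comm (_)⁻¹, ← div_eq_mul_inv,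
    ENNReal.le_div_iff_mul_le (Or.inl hV0) (Or.inl hVt)]
  exact hmean.trans hchange

theorem lintegral_shell_eq [NeZero N] {f : CSpace N → ℂ} (hf : HolOnBall f) {I : Set ℝ}
    (hI : MeasurableSet I) :
    ∫⁻ z in {z | 1 - ‖z‖ ∈ I}, ‖f z‖ₑ ^ 2 ∂(ballMeasure N) =
      (2 * N : ℕ) * ∫⁻ r in Ioi (0 : ℝ), {r | 1 - r ∈ I}.indicator
        (fun r => ENNReal.ofReal (r ^ (2 * N - 1)) * ∫⁻ ξ : sphere (0 : CSpace N) 1,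
          ‖f (r • (ξ : CSpace N))‖ₑ ^ 2 ∂(sphereMeasure N)) r := by
  have hRm : MeasurableSet {z : CSpace N | 1 - ‖z‖ ∈ I} := (measurable_norm.const_sub 1) hI
  rw [← lintegral_indicator hRm, lintegral_polar ((hf.measurable.enorm.pow_const 2).indicator hRm)]
  congr 1
  refine setLIntegral_congr_fun measurableSet_Ioi fun r hr => ?_
  have hnorm : ∀ ξ : sphere (0 : CSpace N) 1, ‖r • (ξ : CSpace N)‖ = r :=
    fun ξ => by simp [norm_smul, abs_of_pos (show (0 : ℝ) < r from hr)]
  by_cases hrI : 1 - r ∈ I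
  · simp [indicator, hnorm, hrI]
  · simp [indicator, hnorm, hrI]

/-- Each spherical mean is at most the squared Hardy norm and the shell lies in radii of total
length (3/2)(1 - |w|). One power of 1 - |w| is regained from the exponent N + 1. -/
theorem exists_hardy_pointEval_le (N : ℕ) [NeZero N] : ∃ C : ℝ, 0 < C ∧ ∀ f : CSpace N → ℂ,
    HolOnBall f → ∀ w : CSpace N, ‖w‖ < 1 →
      ‖f w‖ₑ ^ 2 ≤ ENNReal.ofReal (C * (1 - ‖w‖) ^ (-(N : ℝ))) * hardySq f := by
  have hN : 0 < N := Nat.pos_of_ne_zero (NeZero.ne N)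
  refine ⟨4 ^ N * (2 * N * (3 / 2)), by positivity, fun f hf w hw => ?_⟩
  have hδ : 0 < 1 - ‖w‖ := sub_pos.2 hw
  refine (enorm_sq_le_shell hf hw).trans ?_
  rw [lintegral_shell_eq hf measurableSet_Icc]
  set δ := 1 - ‖w‖
  have h1 : ∫⁻ r in Ioi (0 : ℝ), {r | 1 - r ∈ Icc (3 / 8 * δ) (3 / 2 * δ)}.indicator
        (fun r => ENNReal.ofReal (r ^ (2 * N - 1)) * ∫⁻ ξ : sphere (0 : CSpace N) 1,
          ‖f (r • (ξ : CSpace N))‖ₑ ^ 2 ∂(sphereMeasure N)) r ≤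
      ENNReal.ofReal (3 / 2 * δ) * hardySq f := by
    calc _ ≤ ∫⁻ r in Ioi (0 : ℝ), (Icc (1 - 3 / 2 * δ) 1).indicator (fun _ => hardySq f) r := by
          refine setLIntegral_mono' measurableSet_Ioi fun r hr => ?_
          by_cases hrI : 1 - r ∈ Icc (3 / 8 * δ) (3 / 2 * δ)
          · have hr1 : r ∈ Ioo (0 : ℝ) 1 := ⟨hr, by linarith [hrI.1]⟩
            rw [indicator_of_mem (show r ∈ {r | 1 - r ∈ Icc (3 / 8 * δ) (3 / 2 * δ)} from hrI),
              indicator_of_mem (show r ∈ Icc (1 - 3 / 2 * δ) 1 from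
                ⟨by linarith [hrI.2], hr1.2.le⟩)]
            refine (mul_le_of_le_one_left bot_le (ENNReal.ofReal_le_one.2
              (pow_le_one₀ hr1.1.le hr1.2.le))).trans ?_
            exact le_iSup₂ (f := fun (r : ℝ) (_ : r ∈ Ioo (0 : ℝ) 1) =>
              ∫⁻ ζ : sphere (0 : CSpace N) 1, ‖f (r • (ζ : CSpace N))‖ₑ ^ 2 ∂(sphereMeasure N))
              r hr1
          · rw [indicator_of_notMem (show r ∉ {r | 1 - r ∈ Icc (3 / 8 * δ) (3 / 2 * δ)} from hrI)]
            exact bot_le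
      _ ≤ ∫⁻ r, (Icc (1 - 3 / 2 * δ) 1).indicator (fun _ => hardySq f) r :=
          setLIntegral_le_lintegral _ _
      _ = _ := by
          rw [lintegral_indicator measurableSet_Icc, setLIntegral_const, Real.volume_Icc,
            sub_sub_cancel, mul_comm]
  calc _ ≤ ENNReal.ofReal (4 ^ N * (δ ^ (N + 1))⁻¹) * (ENNReal.ofReal (2 * N) *
        (ENNReal.ofReal (3 / 2 * δ) * hardySq f)) := by
        refine mul_le_mul_right ?_ _
        rw [← ENNReal.ofReal_natCast]
        push_cast
        exact mul_le_mul_right h1 _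
    _ = _ := by
        rw [← mul_assoc, ← mul_assoc, ← ENNReal.ofReal_mul (by positivity),
          ← ENNReal.ofReal_mul (by positivity), Real.rpow_neg hδ.le, Real.rpow_natCast]
        congr 2
        field_simp
        ring

theorem rpow_le_of_mem_Icc {x δ s : ℝ} (hδ : 0 < δ) (hx : x ∈ Icc (1 / 4 * δ) (4 * δ)) :
    δ ^ s ≤ 4 ^ |s| * x ^ s := by
  have hx0 : 0 < x := lt_of_lt_of_le (by positivity) hx.1
  have h1 : (δ / x) ^ s ≤ 4 ^ |s| := by
    rcases le_total 0 s with h | h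
    · rw [abs_of_nonneg h]
      refine Real.rpow_le_rpow (by positivity) ?_ h
      rw [div_le_iff₀ hx0]
      linarith [hx.1]
    · rw [abs_of_nonpos h, Real.rpow_neg (by norm_num), ← Real.inv_rpow (by norm_num)]
      refine Real.rpow_le_rpow_of_nonpos (by norm_num) ?_ h
      rw [le_div_iff₀ hx0]
      linarith [hx.2]
  rw [Real.div_rpow hδ.le hx0.le, div_le_iff₀ (Real.rpow_pos_of_pos hx0 s)] at h1
  exact h1

/-- On the shell around |w| the weight is comparable to (1 - |w|)^s, so it can be inserted in the
unweighted estimate at the cost of that power. -/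
theorem exists_bergman_pointEval_le (N : ℕ) [NeZero N] {s : ℝ} (hs : -1 < s) :
    ∃ C : ℝ, 0 < C ∧ ∀ f : CSpace N → ℂ, HolOnBall f → ∀ w : CSpace N, ‖w‖ < 1 →
      ‖f w‖ₑ ^ 2 ≤
        ENNReal.ofReal (C * (1 - ‖w‖) ^ (-((N : ℝ) + 1 + s))) * bergmanSq s f := by
  have hc := bergmanConst_pos N hs
  refine ⟨4 ^ N * ((bergmanConst N s)⁻¹ * 4 ^ |s|), by positivity, fun f hf w hw => ?_⟩
  have hδ : 0 < 1 - ‖w‖ := sub_pos.2 hw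
  refine (enorm_sq_le_shell hf hw).trans ?_
  rw [lintegral_shell_eq hf measurableSet_Icc, bergmanSq_eq_polar s hf]
  set δ := 1 - ‖w‖
  set κ : ℝ := (bergmanConst N s)⁻¹ * 4 ^ |s| * (δ ^ s)⁻¹ with hκ
  have hκ0 : 0 < κ := by have := Real.rpow_pos_of_pos hδ s; positivity
  have h1 : ∫⁻ r in Ioi (0 : ℝ), {r | 1 - r ∈ Icc (3 / 8 * δ) (3 / 2 * δ)}.indicator
        (fun r => ENNReal.ofReal (r ^ (2 * N - 1)) * ∫⁻ ξ : sphere (0 : CSpace N) 1,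
          ‖f (r • (ξ : CSpace N))‖ₑ ^ 2 ∂(sphereMeasure N)) r ≤
      ENNReal.ofReal κ * ∫⁻ r in Ioo (0 : ℝ) 1, ENNReal.ofReal (r ^ (2 * N - 1)) *
      (ENNReal.ofReal (bergmanConst N s * (1 - r ^ 2) ^ s) *
        ∫⁻ ξ : sphere (0 : CSpace N) 1, ‖f (r • (ξ : CSpace N))‖ₑ ^ 2 ∂(sphereMeasure N)) := by
    rw [← Ioi_inter_Iio, inter_comm, ← setLIntegral_indicator measurableSet_Iio,
      ← lintegral_const_mul' _ _ ENNReal.ofReal_ne_top]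
    refine setLIntegral_mono' measurableSet_Ioi fun r hr => ?_
    by_cases hrI : 1 - r ∈ Icc (3 / 8 * δ) (3 / 2 * δ)
    · have hr0 : 0 < r := hr
      have hr1 : r < 1 := by linarith [hrI.1]
      rw [indicator_of_mem (show r ∈ {r | 1 - r ∈ Icc (3 / 8 * δ) (3 / 2 * δ)} from hrI),
        indicator_of_mem (show r ∈ Iio 1 from hr1), mul_left_comm (ENNReal.ofReal κ)]
      refine mul_le_mul_right ?_ _
      rw [← mul_assoc, ← ENNReal.ofReal_mul hκ0.le]
      refine le_mul_of_one_le_left bot_le (ENNReal.one_le_ofReal.2 ?_)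
      have hx : 1 - r ^ 2 ∈ Icc (1 / 4 * δ) (4 * δ) := by
        have := hrI.1
        have := hrI.2
        constructor <;> nlinarith
      have h2 := rpow_le_of_mem_Icc (s := s) hδ hx
      have h3 := Real.rpow_pos_of_pos hδ s
      calc (1 : ℝ) = δ ^ s * (δ ^ s)⁻¹ := (mul_inv_cancel₀ h3.ne').symm
        _ ≤ (4 ^ |s| * (1 - r ^ 2) ^ s) * (δ ^ s)⁻¹ := by gcongr
        _ = _ := by
            rw [hκ]
            field_simp
    · rw [indicator_of_notMem (show r ∉ {r | 1 - r ∈ Icc (3 / 8 * δ) (3 / 2 * δ)} from hrI)]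
      exact bot_le
  refine (mul_le_mul_right (mul_le_mul_right h1 _) _).trans (le_of_eq ?_)
  rw [mul_left_comm ((2 * N : ℕ) : ℝ≥0∞), ← mul_assoc, ← ENNReal.ofReal_mul (by positivity)]
  congr 2
  rw [hκ, Real.rpow_neg hδ.le, Real.rpow_add hδ, ← Nat.cast_add_one, Real.rpow_natCast, mul_inv]
  ring

end PointEvaluation

/-! ### Compactness tested on normalized kernels -/

section CompactOperator

variable {N : ℕ} {X : Type*} [NormedAddCommGroup X] [NormedSpace ℂ X]

/-- A compact operator on a space of functions with point evaluations of order
`(1 - |w|) ^ (-α / 2)` maps bounded sets with bounded images uniformly to functions of smaller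
order at the boundary. -/
theorem exists_forall_norm_sq_le_of_isCompactOperator (ev : X →ₗ[ℂ] (CSpace N → ℂ))
    {T : X →L[ℂ] X} (hT : IsCompactOperator T) {α C : ℝ} (hα : 0 < α) (hC : 0 < C)
    (hev : ∀ f w, ‖w‖ < 1 → ‖ev f w‖ ^ 2 ≤ C * (1 - ‖w‖) ^ (-α) * ‖f‖ ^ 2)
    {A : Set X} (hA : Bornology.IsBounded A)
    (hTA : ∀ f ∈ A, ∃ B : ℝ, ∀ w, ‖w‖ < 1 → ‖ev (T f) w‖ ≤ B) {ε : ℝ} (hε : 0 < ε) :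
    ∃ δ > 0, ∀ f ∈ A, ∀ w, ‖w‖ < 1 → 1 - ‖w‖ < δ →
      ‖ev (T f) w‖ ^ 2 ≤ ε * (1 - ‖w‖) ^ (-α) := by
  obtain ⟨K, hK, hTK⟩ := IsCompactOperator.image_subset_compact_of_bounded
    (f := T.toLinearMap) hT hA
  have htb : TotallyBounded (T '' A) := hK.totallyBounded.subset hTK
  set μ : ℝ := √(ε / (4 * C)) with hμ
  have hμ0 : 0 < μ := Real.sqrt_pos.2 (by positivity)
  have hμsq : C * μ ^ 2 = ε / 4 := by
    rw [hμ, Real.sq_sqrt (by positivity)]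
    field_simp
  -- The net is chosen inside T(A), so its finitely many members are bounded functions with a common
  -- bound B.
  obtain ⟨t, htA, htfin, htcov⟩ := finite_approx_of_totallyBounded htb μ hμ0
  have hB : ∃ B : ℝ, 0 < B ∧ ∀ g ∈ t, ∀ w, ‖w‖ < 1 → ‖ev g w‖ ≤ B := by
    have h1 : ∀ g : X, ∃ b : ℝ, g ∈ t → ∀ w, ‖w‖ < 1 → ‖ev g w‖ ≤ b := fun g => by
      by_cases hg : g ∈ t
      · obtain ⟨f, hf, rfl⟩ := htA hg
        obtain ⟨b, hb⟩ := hTA f hf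
        exact ⟨b, fun _ => hb⟩
      · exact ⟨0, fun h => absurd h hg⟩
    choose b hb using h1
    obtain ⟨B, hBub⟩ := (htfin.image b).bddAbove
    exact ⟨max B 1, by positivity, fun g hg w hw => (hb g hg w hw).trans
      ((hBub (mem_image_of_mem b hg)).trans (le_max_left _ _))⟩
  obtain ⟨B, hB0, hB⟩ := hB
  -- This δ makes B² ≤ (ε/4)(1 - |w|)^(-α). The net error obeys the same bound by the choice of μ,
  -- and (x + y)² ≤ 2x² + 2y² gives ε.
  refine ⟨(ε / (4 * B ^ 2)) ^ α⁻¹, by positivity, fun f hf w hw hwδ => ?_⟩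
  have hδ : 0 < 1 - ‖w‖ := sub_pos.2 hw
  obtain ⟨g, hg, hgd⟩ := mem_iUnion₂.1 (htcov (mem_image_of_mem T hf))
  have h1 : ‖ev (T f) w‖ ≤ ‖ev g w‖ + ‖ev (T f - g) w‖ := by
    have : ev (T f) w = ev g w + ev (T f - g) w := by simp [map_sub]
    rw [this]
    exact norm_add_le _ _
  have h2 : ‖ev (T f - g) w‖ ^ 2 ≤ ε / 4 * (1 - ‖w‖) ^ (-α) := by
    refine (hev _ w hw).trans ?_
    have hd : ‖T f - g‖ ≤ μ := by
      rw [← dist_eq_norm]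
      exact (mem_ball.1 hgd).le
    have hp := Real.rpow_pos_of_pos hδ (-α)
    calc _ ≤ C * (1 - ‖w‖) ^ (-α) * μ ^ 2 := by gcongr
      _ = C * μ ^ 2 * (1 - ‖w‖) ^ (-α) := by ring
      _ = _ := by rw [hμsq]
  have h3 : ‖ev g w‖ ^ 2 ≤ ε / 4 * (1 - ‖w‖) ^ (-α) := by
    have h4 : (1 - ‖w‖) ^ α ≤ ε / (4 * B ^ 2) := by
      calc _ ≤ ((ε / (4 * B ^ 2)) ^ α⁻¹) ^ α := Real.rpow_le_rpow hδ.le hwδ.le hα.le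
        _ = _ := by rw [← Real.rpow_mul (by positivity), inv_mul_cancel₀ hα.ne', Real.rpow_one]
    have hp := Real.rpow_pos_of_pos hδ α
    rw [Real.rpow_neg hδ.le, ← div_eq_mul_inv, le_div_iff₀ hp]
    calc _ ≤ B ^ 2 * (ε / (4 * B ^ 2)) := by
          gcongr
          exact hB g hg w hw
      _ = _ := by field_simp
  have h5 : ‖ev (T f) w‖ ^ 2 ≤ (‖ev g w‖ + ‖ev (T f - g) w‖) ^ 2 := by gcongr
  nlinarith [sq_nonneg (‖ev g w‖ - ‖ev (T f - g) w‖)]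

/-- Compactness of `C_φ - C_ψ`, tested on kernels. -/
theorem tendsto_kernel_ratio (ev : X →ₗ[ℂ] (CSpace N → ℂ)) {T : X →L[ℂ] X}
    (hT : IsCompactOperator T) {φ ψ : CSpace N → CSpace N} (hφ : IsHolSelfMap φ)
    (hψ : IsHolSelfMap ψ)
    (hTev : ∀ f, ∀ z, ‖z‖ < 1 → ev (T f) z = ev f (φ z) - ev f (ψ z)) {α C C' : ℝ} (hα : 0 < α)
    (hC : 0 < C)
    (hev : ∀ f w, ‖w‖ < 1 → ‖ev f w‖ ^ 2 ≤ C * (1 - ‖w‖) ^ (-α) * ‖f‖ ^ 2) {m : ℕ}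
    (k : CSpace N → X) (hk : ∀ a, ‖a‖ < 1 → ev (k a) = kernelFun m a)
    (hknorm : ∀ a, ‖a‖ < 1 → ‖k a‖ ^ 2 ≤ C' * (1 - ‖a‖) ^ (α - 2 * m))
    {ζ : CSpace N} (hζ : ‖ζ‖ = 1) {D : ℝ}
    (hD : Tendsto (fun r : ℝ => (1 - ‖φ (r • ζ)‖) / (1 - r)) (𝓝[<] 1) (𝓝 D)) :
    Tendsto (fun r : ℝ => (((1 - ‖φ (r • ζ)‖ ^ 2 : ℝ) : ℂ) /
      (1 - inner ℂ (φ (r • ζ)) (ψ (r • ζ)))) ^ m) (𝓝[<] 1) (𝓝 1) := by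
  -- The normalization compensates the norm estimate exactly: |c_a|²‖k_a‖² ≤ C'.
  set c : CSpace N → ℝ := fun a => (1 - ‖a‖) ^ (m - α / 2 : ℝ) with hc
  have hc0 : ∀ a, ‖a‖ < 1 → 0 < c a := fun a ha => Real.rpow_pos_of_pos (sub_pos.2 ha) _
  have hcsq : ∀ a, ‖a‖ < 1 → c a ^ 2 = (1 - ‖a‖) ^ (2 * m - α) := fun a ha => by
    rw [hc, ← Real.rpow_natCast, ← Real.rpow_mul (sub_pos.2 ha).le]
    congr 1
    push_cast
    ring
  set A : Set X := (fun a => (c a : ℂ) • k a) '' ball 0 1 with hA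
  have hAb : Bornology.IsBounded A := by
    refine isBounded_iff_forall_norm_le.2 ⟨√C', ?_⟩
    rintro _ ⟨a, ha, rfl⟩
    have ha1 : ‖a‖ < 1 := by simpa using ha
    refine Real.le_sqrt_of_sq_le ?_
    rw [norm_smul, mul_pow, Complex.norm_real, Real.norm_eq_abs, sq_abs, hcsq a ha1]
    have h0 : 0 < 1 - ‖a‖ := sub_pos.2 ha1
    have hp := Real.rpow_pos_of_pos h0 (2 * m - α)
    calc _ ≤ (1 - ‖a‖) ^ (2 * m - α) * (C' * (1 - ‖a‖) ^ (α - 2 * m)) := by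
          gcongr
          exact hknorm a ha1
      _ = C' * ((1 - ‖a‖) ^ (2 * m - α) * (1 - ‖a‖) ^ (α - 2 * m)) := by ring
      _ = C' := by
          rw [← Real.rpow_add h0]
          ring_nf
          simp
  have hval : ∀ a, ‖a‖ < 1 → ∀ z, ‖z‖ < 1 → ev (T ((c a : ℂ) • k a)) z =
      c a * (kernelFun m a (φ z) - kernelFun m a (ψ z)) := fun a ha z hz => by
    rw [hTev _ z hz, map_smul, hk a ha]
    simp only [Pi.smul_apply, smul_eq_mul]
    ring
  have hTA : ∀ f ∈ A, ∃ B : ℝ, ∀ w, ‖w‖ < 1 → ‖ev (T f) w‖ ≤ B := by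
    rintro _ ⟨a, ha, rfl⟩
    have ha1 : ‖a‖ < 1 := by simpa using ha
    refine ⟨c a * ((1 - ‖a‖)⁻¹ ^ m + (1 - ‖a‖)⁻¹ ^ m), fun w hw => ?_⟩
    rw [hval a ha1 w hw, norm_mul, Complex.norm_real, Real.norm_eq_abs, abs_of_pos (hc0 a ha1)]
    refine mul_le_mul_of_nonneg_left ((norm_sub_le _ _).trans ?_) (hc0 a ha1).le
    exact add_le_add (norm_kernelFun_le m ha1 _) (norm_kernelFun_le m ha1 _)
  have hIoo : ∀ᶠ r : ℝ in 𝓝[<] 1, r ∈ Ioo (0 : ℝ) 1 := Ioo_mem_nhdsLT zero_lt_one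
  rw [tendsto_iff_norm_sub_tendsto_zero]
  set Q : ℝ := |D| + 1 with hQ
  have hQ0 : 0 < Q := by positivity
  have hsq : Tendsto (fun r : ℝ => ‖(((1 - ‖φ (r • ζ)‖ ^ 2 : ℝ) : ℂ) /
      (1 - inner ℂ (φ (r • ζ)) (ψ (r • ζ)))) ^ m - 1‖ ^ 2) (𝓝[<] 1) (𝓝 0) := by
    refine tendsto_order.2 ⟨fun y hy => Eventually.of_forall fun r =>
      hy.trans_le (by positivity), fun y hy => ?_⟩
    -- The final estimate loses 2^(2m) from (1 + |a|)^(2m) and Q^α from ((1 - |a|)/(1 - r))^α; this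
    -- ε absorbs both and leaves y/2 < y.
    set ε : ℝ := y / 2 / (2 ^ (2 * m) * Q ^ α) with hεdef
    have hε : 0 < ε := by positivity
    obtain ⟨δ, hδ, hmain⟩ := exists_forall_norm_sq_le_of_isCompactOperator ev hT hα hC hev hAb
      hTA hε
    have hnear : ∀ᶠ r : ℝ in 𝓝[<] 1, 1 - δ < r :=
      nhdsWithin_le_nhds (lt_mem_nhds (by linarith))
    filter_upwards [hIoo, hnear, hD.eventually (gt_mem_nhds
      (show D < Q by linarith [le_abs_self D]))] with r hr hrδ hrQ
    have hnr : ‖r • ζ‖ = r := by simp [norm_smul, hζ, abs_of_pos hr.1]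
    have hr1 : ‖r • ζ‖ < 1 := hnr.trans_lt hr.2
    have ha := hφ.norm_lt_one hr1
    have hb := hψ.norm_lt_one hr1
    -- The test function and the evaluation point vary together: the kernel at a = φ(rζ) is
    -- evaluated at rζ, which is why the compactness bound must be uniform over A.
    have h1 := hmain _ (mem_image_of_mem _ (show φ (r • ζ) ∈ ball 0 1 by simpa using ha))
      (r • ζ) hr1 (by rw [hnr]; linarith)
    rw [hval _ ha _ hr1, norm_mul, mul_pow, Complex.norm_real, Real.norm_eq_abs, sq_abs,
      hcsq _ ha, kernelFun_apply m _ ha, kernelFun_apply m _ hb, inner_self_eq_norm_sq_to_K,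
      hnr] at h1
    set a := φ (r • ζ)
    set b := ψ (r • ζ)
    have h1r : 0 < 1 - r := sub_pos.2 hr.2
    have hρ0 : 0 ≤ ‖a‖ := norm_nonneg a
    have h1ρ : 0 < 1 - ‖a‖ := sub_pos.2 ha
    have hsqpos := one_sub_norm_sq_pos ha
    set p : ℂ := ((1 - ‖a‖ ^ 2 : ℝ) : ℂ) with hp
    have hp0 : p ≠ 0 := by
      rw [hp]
      exact_mod_cast hsqpos.ne'
    have hpn : ‖p‖ = 1 - ‖a‖ ^ 2 := by
      rw [hp, Complex.norm_real, Real.norm_eq_abs, abs_of_pos hsqpos]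
    have hpeq : (1 : ℂ) - (RCLike.ofReal ‖a‖ : ℂ) ^ 2 = p := by
      rw [hp]
      push_cast
      rfl
    have hq0 := one_sub_inner_ne_zero (w := a) (z := b) ha.le hb
    set q : ℂ := 1 - inner ℂ a b
    rw [hpeq] at h1
    have h2 : p⁻¹ ^ m - q⁻¹ ^ m = -(p⁻¹ ^ m * ((p / q) ^ m - 1)) := by
      rw [div_pow, inv_pow, inv_pow]
      field_simp
      ring
    rw [h2, norm_neg, norm_mul, mul_pow, norm_pow, norm_inv, hpn] at h1
    have h3 : (1 - ‖a‖) ^ (2 * m - α) * ((1 - ‖a‖ ^ 2)⁻¹ ^ m) ^ 2 =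
        ((1 + ‖a‖) ^ (2 * m))⁻¹ * (1 - ‖a‖) ^ (-α) := by
      have h4 : (1 - ‖a‖) ^ (2 * m - α) = (1 - ‖a‖) ^ (2 * m) * (1 - ‖a‖) ^ (-α) := by
        have h5 : (1 - ‖a‖) ^ (2 * m) = (1 - ‖a‖) ^ (2 * m : ℝ) := by
          exact_mod_cast (Real.rpow_natCast (1 - ‖a‖) (2 * m)).symm
        rw [h5, sub_eq_add_neg (2 * m : ℝ), Real.rpow_add h1ρ]
      have h5 : 1 - ‖a‖ ^ 2 = (1 - ‖a‖) * (1 + ‖a‖) := by ring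
      rw [h4, h5, ← pow_mul, mul_comm m 2, inv_pow, mul_pow]
      field_simp
    rw [← mul_assoc, h3] at h1
    set x : ℝ := ‖(p / q) ^ m - 1‖ ^ 2
    have h6 : x ≤ ε * ((1 + ‖a‖) ^ (2 * m) * ((1 - ‖a‖) / (1 - r)) ^ α) := by
      rw [Real.rpow_neg h1ρ.le, Real.rpow_neg h1r.le] at h1
      have hP := Real.rpow_pos_of_pos h1ρ α
      have hR := Real.rpow_pos_of_pos h1r α
      rw [Real.div_rpow h1ρ.le h1r.le]
      have hM : 0 < (1 + ‖a‖) ^ (2 * m) := by positivity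
      calc x = ((1 + ‖a‖) ^ (2 * m) * (1 - ‖a‖) ^ α) *
            (((1 + ‖a‖) ^ (2 * m))⁻¹ * ((1 - ‖a‖) ^ α)⁻¹ * x) := by field_simp
        _ ≤ ((1 + ‖a‖) ^ (2 * m) * (1 - ‖a‖) ^ α) * (ε * ((1 - r) ^ α)⁻¹) := by gcongr
        _ = _ := by ring
    calc x ≤ ε * (2 ^ (2 * m) * Q ^ α) := by
          refine h6.trans ?_
          have : 0 ≤ (1 - ‖a‖) / (1 - r) := by positivity
          gcongr
          linarith
      _ = y / 2 := by
          rw [hεdef]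
          field_simp
      _ < y := by linarith
  have := hsq.sqrt
  simpa [Real.sqrt_sq] using this

end CompactOperator

/-! ### From kernel ratios to radial limits and dilation coefficients -/

section Comparison

variable {N : ℕ}

/-- If the normalized kernel at `φ(rζ)` takes asymptotically the same value at `φ(rζ)` and
`ψ(rζ)`, then `φ` and `ψ` have the same radial limit and `d_ψ ≤ d_φ`. -/
theorem radialLimit_and_dilationCoeff_le {φ ψ : CSpace N → CSpace N} (hφ : IsHolSelfMap φ)
    (hψ : IsHolSelfMap ψ) {ζ η : CSpace N} (hζ : ‖ζ‖ = 1) (hη : ‖η‖ = 1)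
    (hlim : HasRadialLimit φ ζ η) {D : ℝ}
    (hD : Tendsto (fun r : ℝ => (1 - ‖φ (r • ζ)‖) / (1 - r)) (𝓝[<] 1) (𝓝 D)) {m : ℕ} (hm : m ≠ 0)
    (hker : Tendsto (fun r : ℝ => (((1 - ‖φ (r • ζ)‖ ^ 2 : ℝ) : ℂ) /
      (1 - inner ℂ (φ (r • ζ)) (ψ (r • ζ)))) ^ m) (𝓝[<] 1) (𝓝 1)) :
    HasRadialLimit ψ ζ η ∧ dilationCoeff ψ ζ ≤ D := by
  have hIoo : ∀ᶠ r : ℝ in 𝓝[<] 1, r ∈ Ioo (0 : ℝ) 1 := Ioo_mem_nhdsLT zero_lt_one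
  have hnorm : ∀ r ∈ Ioo (0 : ℝ) 1, ‖r • ζ‖ = r := fun r hr => by
    simp [norm_smul, hζ, abs_of_pos hr.1]
  have hφ1 : ∀ r ∈ Ioo (0 : ℝ) 1, ‖φ (r • ζ)‖ < 1 := fun r hr =>
    hφ.norm_lt_one (by rw [hnorm r hr]; exact hr.2)
  have hψ1 : ∀ r ∈ Ioo (0 : ℝ) 1, ‖ψ (r • ζ)‖ < 1 := fun r hr =>
    hψ.norm_lt_one (by rw [hnorm r hr]; exact hr.2)
  set x : ℝ → ℝ := fun r => ‖((1 - ‖φ (r • ζ)‖ ^ 2 : ℝ) : ℂ) /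
      (1 - inner ℂ (φ (r • ζ)) (ψ (r • ζ)))‖ with hx
  -- Taking moduli before the m-th root makes the root unambiguous; the argument of the ratio is not
  -- needed.
  have hxlim : Tendsto x (𝓝[<] 1) (𝓝 1) := by
    have h1 := hker.norm.rpow_const (p := ((m : ℝ)⁻¹)) (Or.inl (by simp))
    simp only [norm_one, Real.one_rpow, norm_pow] at h1
    refine h1.congr fun r => ?_
    exact Real.pow_rpow_inv_natCast (norm_nonneg _) hm
  have hxeq : ∀ r ∈ Ioo (0 : ℝ) 1,
      x r * ‖1 - inner ℂ (φ (r • ζ)) (ψ (r • ζ))‖ = 1 - ‖φ (r • ζ)‖ ^ 2 := by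
    intro r hr
    have h1 := norm_ne_zero_iff.2 (one_sub_inner_ne_zero (hφ1 r hr).le (hψ1 r hr))
    simp only [hx]
    rw [norm_div, div_mul_cancel₀ _ h1, Complex.norm_real, Real.norm_eq_abs,
      abs_of_pos (one_sub_norm_sq_pos (hφ1 r hr))]
  have hxhalf : ∀ᶠ r in 𝓝[<] 1, 1 / 2 < x r := hxlim.eventually (lt_mem_nhds (by norm_num))
  have hρ : Tendsto (fun r : ℝ => ‖φ (r • ζ)‖) (𝓝[<] 1) (𝓝 1) := by
    have := Tendsto.norm hlim
    rwa [hη] at this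
  constructor
  · refine tendsto_of_tendsto_one_sub_inner (hIoo.mono fun r hr => (hφ1 r hr).le)
      (hIoo.mono fun r hr => (hψ1 r hr).le) ?_ hlim
    have h0 : Tendsto (fun r : ℝ => (1 - ‖φ (r • ζ)‖ ^ 2) / x r) (𝓝[<] 1) (𝓝 0) := by
      have := ((hρ.pow 2).const_sub 1).div hxlim one_ne_zero
      simp only [one_pow, sub_self, zero_div] at this
      exact this
    refine h0.congr' ?_
    filter_upwards [hIoo, hxhalf] with r hr hxr
    have : x r ≠ 0 := by positivity
    rw [← hxeq r hr, mul_div_cancel_left₀ _ this]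
  -- With ρ = |φ|, β = |ψ| and x the modulus of the ratio, 1 - ρβ ≤ (1 - ρ²)/x. Subtracting 1 - ρ
  -- gives ρ(1 - β) ≤ (1 - ρ)((1 + ρ)/x - 1), whose last factor tends to 1. The function here is the
  -- resulting majorant of (1 - β)/(1 - r).
  · have hg : Tendsto (fun r : ℝ => (1 - ‖φ (r • ζ)‖) / (1 - r) *
        (((1 + ‖φ (r • ζ)‖) / x r - 1) / ‖φ (r • ζ)‖)) (𝓝[<] 1) (𝓝 D) := by
      have h1 := hD.mul ((((hρ.const_add 1).div hxlim one_ne_zero).sub_const 1).div hρ one_ne_zero)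
      norm_num at h1
      exact h1
    refine EReal.le_of_forall_lt_iff_le.1 fun y hy => ?_
    have hy' : D < y := by exact_mod_cast hy
    have hev : ∀ᶠ r : ℝ in 𝓝[<] 1, (1 - ‖ψ (r • ζ)‖) / (1 - ‖r • ζ‖) ≤ y := by
      filter_upwards [hIoo, hxhalf, hg.eventually (gt_mem_nhds hy'),
        hρ.eventually (lt_mem_nhds zero_lt_one)] with r hr hxr hlt hρ0
      refine le_trans ?_ hlt.le
      have hb := hψ1 r hr
      have ha := hφ1 r hr
      have hx0 : 0 < x r := by linarith
      have h1r : 0 < 1 - r := sub_pos.2 hr.2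
      have hin : 1 - ‖φ (r • ζ)‖ * ‖ψ (r • ζ)‖ ≤ ‖1 - inner ℂ (φ (r • ζ)) (ψ (r • ζ))‖ := by
        have h1 := norm_inner_le_norm (𝕜 := ℂ) (φ (r • ζ)) (ψ (r • ζ))
        have h2 := norm_sub_norm_le (1 : ℂ) (inner ℂ (φ (r • ζ)) (ψ (r • ζ)))
        rw [norm_one] at h2
        linarith
      have heq := hxeq r hr
      rw [hnorm r hr]
      set ρ := ‖φ (r • ζ)‖
      set β := ‖ψ (r • ζ)‖
      have hdiv : 1 - ρ * β ≤ (1 - ρ ^ 2) / x r := by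
        rw [le_div_iff₀ hx0, ← heq, mul_comm]
        gcongr
      have hfin : ρ * (1 - β) ≤ (1 - ρ) * ((1 + ρ) / x r - 1) := by
        have h3 : (1 - ρ) * ((1 + ρ) / x r - 1) = (1 - ρ ^ 2) / x r - (1 - ρ) := by ring
        rw [h3]
        linarith
      have h4 : 1 - β ≤ (1 - ρ) * ((1 + ρ) / x r - 1) / ρ := by
        rw [le_div_iff₀ hρ0, mul_comm]
        exact hfin
      calc (1 - β) / (1 - r) ≤ ((1 - ρ) * ((1 + ρ) / x r - 1) / ρ) / (1 - r) := by gcongr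
        _ = _ := by ring
    exact liminf_le_of_frequently_le ((tendsto_radial hζ).frequently
      (hev.frequently.mono fun r hr => by exact_mod_cast hr)) (by isBoundedDefault)

end Comparison

/-! ### Application to the Hardy and Bergman spaces -/

section Spaces

variable {N : ℕ} [NeZero N]

theorem norm_sq_le_of_enorm_sq_le {z : ℂ} {A : ℝ} (hA : 0 ≤ A) {b : ℝ≥0∞} (hb : b ≠ ∞)
    (h : ‖z‖ₑ ^ 2 ≤ ENNReal.ofReal A * b) : ‖z‖ ^ 2 ≤ A * √b.toReal ^ 2 := by
  rw [Real.sq_sqrt ENNReal.toReal_nonneg]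
  have h1 := ENNReal.toReal_mono (ENNReal.mul_ne_top ENNReal.ofReal_ne_top hb) h
  rwa [ENNReal.toReal_pow, toReal_enorm, ENNReal.toReal_mul, ENNReal.toReal_ofReal hA] at h1

theorem sqrt_toReal_sq_le {A : ℝ} (hA : 0 ≤ A) {b : ℝ≥0∞} (h : b ≤ ENNReal.ofReal A) :
    √b.toReal ^ 2 ≤ A := by
  rw [Real.sq_sqrt ENNReal.toReal_nonneg]
  exact ENNReal.toReal_le_of_le_ofReal hA h

/-- A compact difference of composition operators has, along radii, asymptotically equal kernel
values. -/
theorem exists_tendsto_kernel_ratio {φ ψ : CSpace N → CSpace N} (hφ : IsHolSelfMap φ)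
    (hψ : IsHolSelfMap ψ)
    (hcomp : HardyCompactDifference φ ψ ∨
      ∃ (s : ℝ) (hs : -1 < s), BergmanCompactDifference s hs φ ψ)
    {ζ : CSpace N} (hζ : ‖ζ‖ = 1) {D : ℝ}
    (hD : Tendsto (fun r : ℝ => (1 - ‖φ (r • ζ)‖) / (1 - r)) (𝓝[<] 1) (𝓝 D)) :
    ∃ m : ℕ, m ≠ 0 ∧ Tendsto (fun r : ℝ => (((1 - ‖φ (r • ζ)‖ ^ 2 : ℝ) : ℂ) /
      (1 - inner ℂ (φ (r • ζ)) (ψ (r • ζ)))) ^ m) (𝓝[<] 1) (𝓝 1) := by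
  classical
  have hN : 0 < N := Nat.pos_of_ne_zero (NeZero.ne N)
  have hNr : (0 : ℝ) < N := by exact_mod_cast hN
  rcases hcomp with ⟨Cφ, Cψ, h1, h2, hT⟩ | ⟨s, hs, Cφ, Cψ, h1, h2, hT⟩
  · obtain ⟨C, hC, hpt⟩ := exists_hardy_pointEval_le N
    obtain ⟨C', hC', hker⟩ := exists_hardySq_kernelFun_le N (m := N) (by omega)
    -- For α = N the choice m = N satisfies 2m > α and is nonzero because N ≥ 1.
    refine ⟨N, hN.ne', ?_⟩
    let ev : HardySpace N →ₗ[ℂ] (CSpace N → ℂ) :=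
      { toFun := fun f => f
        map_add' := fun _ _ => rfl
        map_smul' := fun _ _ => rfl }
    let k : CSpace N → HardySpace N := fun a =>
      if ha : ‖a‖ < 1 then ⟨kernelFun N a, holOnBall_kernelFun N ha,
        (hker a ha).trans_lt ENNReal.ofReal_lt_top⟩ else 0
    have hk : ∀ a, ‖a‖ < 1 → ev (k a) = kernelFun N a := fun a ha => congrArg ev (dif_pos ha)
    refine tendsto_kernel_ratio (C' := C') ev hT hφ hψ (fun f z hz => ?_) hNr hC (fun f w hw => ?_) k hk
      (fun a ha => ?_) hζ hD
    · have hz' : z ∈ ball (0 : CSpace N) 1 := by simpa using hz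
      exact congrArg₂ (· - ·) (h1 f z hz') (h2 f z hz')
    · have := Real.rpow_nonneg (sub_pos.2 hw).le (-(N : ℝ))
      exact norm_sq_le_of_enorm_sq_le (by positivity) f.2.2.ne (hpt f f.2.1 w hw)
    · have := Real.rpow_nonneg (sub_pos.2 ha).le ((N : ℝ) - 2 * N)
      refine sqrt_toReal_sq_le (by positivity) ?_
      change hardySq (ev (k a)) ≤ _
      rw [hk a ha]
      exact hker a ha
  · obtain ⟨C, hC, hpt⟩ := exists_bergman_pointEval_le N hs
    -- As α = N + 1 + s is positive, m > α gives 2m > α and m ≠ 0.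
    obtain ⟨m, hm⟩ := exists_nat_gt ((N : ℝ) + 1 + s)
    have hα : (0 : ℝ) < N + 1 + s := by linarith
    have hm0 : (0 : ℝ) < m := hα.trans hm
    obtain ⟨C', hC', hker⟩ := exists_bergmanSq_kernelFun_le N hs (m := m) (by linarith)
    refine ⟨m, by exact_mod_cast hm0.ne', ?_⟩
    let ev : BergmanSpace N s hs →ₗ[ℂ] (CSpace N → ℂ) :=
      { toFun := fun f => f
        map_add' := fun _ _ => rfl
        map_smul' := fun _ _ => rfl }
    let k : CSpace N → BergmanSpace N s hs := fun a =>
      if ha : ‖a‖ < 1 then ⟨kernelFun m a, holOnBall_kernelFun m ha,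
        (hker a ha).trans_lt ENNReal.ofReal_lt_top⟩ else 0
    have hk : ∀ a, ‖a‖ < 1 → ev (k a) = kernelFun m a := fun a ha => congrArg ev (dif_pos ha)
    refine tendsto_kernel_ratio (C' := C') ev hT hφ hψ (fun f z hz => ?_) hα hC (fun f w hw => ?_) k hk
      (fun a ha => ?_) hζ hD
    · have hz' : z ∈ ball (0 : CSpace N) 1 := by simpa using hz
      exact congrArg₂ (· - ·) (h1 f z hz') (h2 f z hz')
    · have := Real.rpow_nonneg (sub_pos.2 hw).le (-((N : ℝ) + 1 + s))
      exact norm_sq_le_of_enorm_sq_le (by positivity) f.2.2.ne (hpt f f.2.1 w hw)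
    · have := Real.rpow_nonneg (sub_pos.2 ha).le ((N : ℝ) + 1 + s - 2 * m)
      refine sqrt_toReal_sq_le (by positivity) ?_
      change bergmanSq s (ev (k a)) ≤ _
      rw [hk a ha]
      exact hker a ha

theorem compactDifference_symm {φ ψ : CSpace N → CSpace N}
    (h : HardyCompactDifference φ ψ ∨
      ∃ (s : ℝ) (hs : -1 < s), BergmanCompactDifference s hs φ ψ) :
    HardyCompactDifference ψ φ ∨
      ∃ (s : ℝ) (hs : -1 < s), BergmanCompactDifference s hs ψ φ := by
  rcases h with ⟨Cφ, Cψ, h1, h2, hT⟩ | ⟨s, hs, Cφ, Cψ, h1, h2, hT⟩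
  · refine Or.inl ⟨Cψ, Cφ, h2, h1, ?_⟩
    rw [← neg_sub]
    exact hT.neg
  · refine Or.inr ⟨s, hs, Cψ, Cφ, h2, h1, ?_⟩
    rw [← neg_sub]
    exact hT.neg

end Spaces

theorem corollary2p2 (N : ℕ) [NeZero N] (φ ψ : CSpace N → CSpace N)
    (hφ : IsHolSelfMap φ) (hψ : IsHolSelfMap ψ)
    (hcomp : HardyCompactDifference φ ψ ∨
      ∃ (s : ℝ) (hs : -1 < s), BergmanCompactDifference s hs φ ψ)
    (ζ : CSpace N) (hζ : ζ ∈ sphere (0 : CSpace N) 1)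
    (hang : HasFiniteAngularDerivative φ ζ) :
    (∃ η : CSpace N, HasRadialLimit φ ζ η ∧ HasRadialLimit ψ ζ η) ∧
      dilationCoeff φ ζ = dilationCoeff ψ ζ := by
  have hζ1 : ‖ζ‖ = 1 := by simpa using hζ
  obtain ⟨D, -, hD, ⟨η, hη, hlim⟩, hDlim⟩ :=
    julia_caratheodory_radial hφ hζ1 (hang.dilationCoeff_lt_top hζ1)
  obtain ⟨m, hm, hker⟩ := exists_tendsto_kernel_ratio hφ hψ hcomp hζ1 hDlim
  obtain ⟨hψlim, hle⟩ := radialLimit_and_dilationCoeff_le hφ hψ hζ1 hη hlim hDlim hm hker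
  -- No angular derivative is assumed for ψ. The inequality just proved makes its dilation
  -- coefficient finite, and that is all the reversed argument requires.
  obtain ⟨D', -, hD', -, hDlim'⟩ :=
    julia_caratheodory_radial hψ hζ1 (hle.trans_lt (EReal.coe_lt_top D))
  obtain ⟨m', hm', hker'⟩ :=
    exists_tendsto_kernel_ratio hψ hφ (compactDifference_symm hcomp) hζ1 hDlim'
  obtain ⟨-, hle'⟩ := radialLimit_and_dilationCoeff_le hψ hφ hζ1 hη hψlim hDlim' hm' hker'
  exact ⟨⟨η, hlim, hψlim⟩, le_antisymm (hD' ▸ hle') (hD ▸ hle)⟩
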